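/- Let $\mathcal P$ be the set of prime numbers, and let $\mathcal A_f=\prod'_{p\in\mathcal P}(\mathbb Q_p,\mathbb Z_p)$ be the ring of finite adeles, i.e. the restricted product of the fields $\mathbb Q_p$ with respect to the subrings $\mathbb Z_p$, with its restricted product topology and Borel $\sigma$-algebra. The multiplicative group $\mathbb Q^*_+$ of positive rationals is embedded diagonally into $\mathcal A_f$ and acts on $\mathcal A_f$ by multiplication. For $\beta>0$ and $p\in\mathcal P$ let $\mu_{1,p}$ be the Haar measure on the additive group $\mathbb Q_p$ with $\mu_{1,p}(\mathbb Z_p)=1$, and let $\mu_{\beta,p}$ be the measure on $\mathbb Q_p$ with $$\frac{d\mu_{\beta,p}}{d\mu_{1,p}}(a)=\frac{1-p^{-\beta}}{1-p^{-1}}\,|a|_p^{\beta-1},\qquad a\in\mathbb Q_p,$$ so that $\mu_{\beta,p}(\mathbb Z_p)=1$. Let $\mu_\beta=\bigotimes_{p\in\mathcal P}\mu_{\beta,p}$ be the product measure on $\mathcal A_f$. **Proposition.** For every $\beta\in(0,1]$ the action of $\mathbb Q^*_+$ on $(\mathcal A_f,\mu_\beta)$ is ergodic. That is, each $q\in\mathbb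 Q^*_+$ acts by a non-singular transformation (preimages of $\mu_\beta$-null sets are $\mu_\beta$-null), and every Borel set $X\subset\mathcal A_f$ such that, for all $q\in\mathbb Q^*_+$, $q^{-1}X$ and $X$ differ by a $\mu_\beta$-null set satisfies $\mu_\beta(X)=0$ or $\mu_\beta(\mathcal A_f\setminus X)=0$. -/

import Mathlib

open scoped RestrictedProduct ENNReal
open MeasureTheory

noncomputable section

namespace FiniteAdele

/-- The set `𝒫` of prime numbers. -/
abbrev PrimeIndex : Type := {p : ℕ // p.Prime}

instance factPrime (p : PrimeIndex) : Fact (p : ℕ).Prime := ⟨p.2⟩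

/-- `ℚ_p` carries its Borel σ-algebra. -/
instance padicMeasurableSpace (p : ℕ) [Fact p.Prime] : MeasurableSpace ℚ_[p] := borel _

instance padicBorelSpace (p : ℕ) [Fact p.Prime] : BorelSpace ℚ_[p] := ⟨rfl⟩

/-- `ℤ_p` carries its Borel σ-algebra. -/
instance padicIntMeasurableSpace (p : ℕ) [Fact p.Prime] : MeasurableSpace ℤ_[p] := borel _

instance padicIntBorelSpace (p : ℕ) [Fact p.Prime] : BorelSpace ℤ_[p] := ⟨rfl⟩

/-- The ring `𝒜_f` of finite adeles: the restricted product of the fields `ℚ_p` with respect to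
the subrings `ℤ_p`, over all primes `p`. It has the componentwise ring structure and the
restricted product topology. -/
abbrev Adeles : Type := Πʳ p : PrimeIndex, [ℚ_[(p : ℕ)], PadicInt.subring (p : ℕ)]

/-- The finite adeles carry the Borel σ-algebra of the restricted product topology. -/
instance adelesMeasurableSpace : MeasurableSpace Adeles := borel _

instance adelesBorelSpace : BorelSpace Adeles := ⟨rfl⟩

/-! ### The action of the positive rationals -/

theorem finite_nonintegral (q : ℚ) :
    ∀ᶠ p : PrimeIndex in Filter.cofinite,
      (q : ℚ_[(p : ℕ)]) ∈ (PadicInt.subring (p : ℕ) : Set ℚ_[(p : ℕ)]) := by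
  have h : Set.Finite {p : PrimeIndex | (p : ℕ) ∣ q.den} := by
    refine Set.Finite.of_finite_image (f := fun p : PrimeIndex => (p : ℕ)) ?_
      (fun a _ b _ hab => Subtype.ext hab)
    refine (Set.finite_Iic q.den).subset ?_
    rintro _ ⟨p, hp, rfl⟩
    exact Nat.le_of_dvd q.den_pos hp
  refine Filter.mem_of_superset h.compl_mem_cofinite ?_
  intro p hp
  exact Padic.norm_rat_le_one hp

/-- The diagonal embedding of `ℚ` into the finite adeles. -/
def diag : ℚ →+* Adeles where
  toFun q := ⟨fun p => (q : ℚ_[(p : ℕ)]), finite_nonintegral q⟩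
  map_one' := by ext p; exact Rat.cast_one
  map_mul' a b := by ext p; exact Rat.cast_mul a b
  map_zero' := by ext p; exact Rat.cast_zero
  map_add' a b := by ext p; exact Rat.cast_add a b

/-- The multiplicative group `ℚ_+^*` of positive rationals. -/
abbrev PosRat : Type := {q : ℚ // 0 < q}

/-- `ℚ_+^*` acts on the finite adeles by multiplication through the diagonal embedding. -/
instance posRatAction : MulAction PosRat Adeles where
  smul q x := diag (q : ℚ) * x
  one_smul x := by
    change diag ((1 : PosRat) : ℚ) * x = x
    rw [Positive.val_one, map_one, one_mul]
  mul_smul q r x := by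
    change diag ((q * r : PosRat) : ℚ) * x = diag (q : ℚ) * (diag (r : ℚ) * x)
    rw [Positive.val_mul, map_mul, mul_assoc]

/-! ### The local measures -/

/-- `ℤ_p` as a compact subset of `ℚ_p` with non-empty interior. -/
def integers (p : ℕ) [Fact p.Prime] : TopologicalSpace.PositiveCompacts ℚ_[p] where
  carrier := PadicInt.subring p
  isCompact' := isCompact_iff_compactSpace.mpr (PadicInt.compactSpace p)
  interior_nonempty' := by
    have h : IsOpen (PadicInt.subring p : Set ℚ_[p]) := by
      have h' := (PadicInt.isOpenEmbedding_coe (p := p)).isOpen_range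
      convert h' using 1
      ext x
      exact ⟨fun hx => ⟨⟨x, hx⟩, rfl⟩, fun ⟨y, hy⟩ => hy ▸ y.2⟩
    rw [h.interior_eq]
    exact ⟨0, zero_mem _⟩

/-- The Haar measure `μ_{1,p}` of the additive group `ℚ_p`, normalized by `μ_{1,p}(ℤ_p) = 1`. -/
def haar (p : ℕ) [Fact p.Prime] : Measure ℚ_[p] := Measure.addHaarMeasure (integers p)

/-- The measure `μ_{β,p}` on `ℚ_p`, of density
`(1 - p^{-β}) / (1 - p^{-1}) * |a|_p^{β-1}` with respect to `μ_{1,p}`. -/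
def localMeasure (β : ℝ) (p : ℕ) [Fact p.Prime] : Measure ℚ_[p] :=
  (haar p).withDensity fun a =>
    ENNReal.ofReal ((1 - (p : ℝ) ^ (-β)) / (1 - (p : ℝ) ^ (-1 : ℝ)) * ‖a‖ ^ (β - 1))

/-! ### Products of measures over the restricted product -/

/-- For a finite set `S` of primes, the obvious map
`∏_{p ∈ S} ℚ_p × ∏_{p ∉ S} ℤ_p → 𝒜_f`. -/
def glue (S : Finset PrimeIndex)
    (x : (∀ p : {p : PrimeIndex // p ∈ S}, ℚ_[((p : PrimeIndex) : ℕ)]) ×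
      (∀ p : {p : PrimeIndex // p ∉ S}, ℤ_[((p : PrimeIndex) : ℕ)])) : Adeles :=
  ⟨fun p => if h : p ∈ S then x.1 ⟨p, h⟩ else ((x.2 ⟨p, h⟩ : ℤ_[(p : ℕ)]) : ℚ_[(p : ℕ)]), by
    refine Filter.mem_of_superset S.finite_toSet.compl_mem_cofinite ?_
    intro p hp
    have hp' : p ∉ S := hp
    simp only [Set.mem_ofPred_eq, dif_neg hp']
    exact (x.2 ⟨p, hp'⟩).2⟩

/-- The restriction to `ℤ_p` of a measure on `ℚ_p`, as a measure on the space `ℤ_p`. -/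
def integralPart {p : ℕ} [Fact p.Prime] (ν : Measure ℚ_[p]) : Measure ℤ_[p] :=
  ν.comap ((↑) : ℤ_[p] → ℚ_[p])

/-- The product `⊗_p ν_p` on the finite adeles of measures `ν_p` on `ℚ_p` with `ν_p(ℤ_p) = 1`.
The adeles are the disjoint union, over the finite sets `S` of primes, of the sets
`∏_{p ∈ S} (ℚ_p ∖ ℤ_p) × ∏_{p ∉ S} ℤ_p`, and on each of these countably many pieces
`⊗_p ν_p` is the usual product measure: a finite product of measures times an infinite product
of probability measures. -/
def productMeasure (ν : ∀ p : PrimeIndex, Measure ℚ_[(p : ℕ)]) : Measure Adeles :=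
  Measure.sum fun S : Finset PrimeIndex =>
    Measure.map (glue S)
      ((Measure.pi fun p : {p : PrimeIndex // p ∈ S} =>
          (ν p).restrict (PadicInt.subring ((p : PrimeIndex) : ℕ) : Set ℚ_[((p : PrimeIndex) : ℕ)])ᶜ).prod
        (Measure.infinitePi fun p : {p : PrimeIndex // p ∉ S} =>
          integralPart (ν p)))

/-- The measure `μ_β = ⊗_p μ_{β,p}` on the finite adeles. -/
def adelicMeasure (β : ℝ) : Measure Adeles := productMeasure fun p => localMeasure β (p : ℕ)

/-! ### Ergodicity -/

/-- A (not necessarily measure-preserving) action of a group `G` on a measure space `(X, μ)` is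
ergodic if `G` acts by non-singular transformations and every measurable set that is invariant
under each `g : G` up to `μ`-null sets is `μ`-null or has `μ`-null complement. -/
structure IsErgodicAction (G : Type*) {X : Type*} [Group G] [MulAction G X] [MeasurableSpace X]
    (μ : Measure X) : Prop where
  quasiInvariant : ∀ g : G, Measure.QuasiMeasurePreserving (fun x : X => g • x) μ μ
  null_or_conull : ∀ s : Set X, MeasurableSet s →
    (∀ g : G, (fun x : X => g • x) ⁻¹' s =ᵐ[μ] s) → μ s = 0 ∨ μ sᶜ = 0

end FiniteAdele

end

/-!
Let `W = ∏_p ℤ_p` be the set of integral adeles, which has `μ_β`-measure `1`. All that is needed of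
`μ_β` is the scaling rule `μ_β (n⁻¹ E) = n ^ β μ_β (E)` for positive integers `n`
(`preimage_smul_nat`) and the measure of the sets of integral adeles that are units at finitely many
primes. Since every adele has an integral multiple, an invariant set `X` is determined, up to null
sets, by `X ∩ W`, and it suffices to show that `X` is independent of every residue class
`a + N W` under the restriction of `μ_β` to `W`: these classes generate the Borel sets of `W`, so
that `X` is then independent of its own complement.

Let `h : W → ℂ` be bounded with `h (q x) = c_q h x` for all primes `q`. The scaling rule shows that
the integral of `1_X h` over `q W` is `c_q q ^ (-β)` times the integral over `W`. Removing the
multiples of the primes of a finite set `A` therefore gives (`setIntegral_integralAdeles`)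

  `∫_{W_A} 1_X h = ∏_{q ∈ A} (1 - c_q q ^ (-β)) ∫_W 1_X h`,

where `W_A` is the set of integral adeles that are units at the primes of `A`, a set of measure
`∏_{q ∈ A} (1 - q ^ (-β))`. For a Dirichlet character `χ` modulo `N`, the function
`h x = χ (x mod N)` has this property with `c_q = χ q`. If `χ` is not trivial, the quotients
`∏_{q ∈ A} (1 - q ^ (-β)) / |1 - χ q q ^ (-β)|` come arbitrarily close to `0`: they decrease as the
exponent does, and as the exponent tends to `1` from above, `ζ` has a pole while `L(χ, ·)` stays
bounded (`exists_eulerFactor_prod_lt`; this is where `β ≤ 1` enters). Hence `∫_W 1_X h = 0`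
(`setIntegral_charFn_eq_zero`). By orthogonality of characters, `μ_β (X ∩ (a + N W))` is, for `a`
prime to `N`, the same multiple of `μ_β (X ∩ W)` for all invariant sets `X`; comparing with the
invariant set of all adeles gives the independence. A class with `gcd (a, N) = d` is `d` times
a class of this kind.
-/

noncomputable section

namespace FiniteAdele

/-! ### The local measures -/

section Local

variable {p : ℕ} [Fact p.Prime]

theorem padic_norm_natCast_le_one (n : ℕ) : ‖(n : ℚ_[p])‖ ≤ 1 := by
  simpa using Padic.norm_int_le_one (p := p) n

theorem coe_integers : (PadicInt.subring p : Set ℚ_[p]) = Metric.closedBall 0 1 := by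
  ext x
  simp [PadicInt.mem_subring_iff]

theorem padic_norm_le_inv_of_lt_one {x : ℚ_[p]} (hx : ‖x‖ < 1) : ‖x‖ ≤ (p : ℝ)⁻¹ := by
  have := (Padic.norm_le_pow_iff_norm_lt_pow_add_one x (-1)).2 (by simpa using hx)
  simpa using this

theorem padic_norm_sub_le (x y : ℚ_[p]) : ‖x - y‖ ≤ max ‖x‖ ‖y‖ := by
  rw [sub_eq_add_neg, ← norm_neg y]
  exact Padic.nonarchimedean _ _

theorem exists_natCast_near {x : ℚ_[p]} (hx : ‖x‖ ≤ 1) :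
    ∃ n < p, ‖x - (n : ℚ_[p])‖ ≤ (p : ℝ)⁻¹ := by
  let y : ℤ_[p] := ⟨x, hx⟩
  obtain ⟨n, hn, h⟩ := PadicInt.exists_mem_range y
  refine ⟨n, hn, padic_norm_le_inv_of_lt_one ?_⟩
  rw [IsLocalRing.mem_maximalIdeal, PadicInt.mem_nonunits] at h
  rw [PadicInt.norm_def, PadicInt.coe_sub, PadicInt.coe_natCast] at h
  exact h

theorem haar_unitBall : haar p (Metric.closedBall 0 1) = 1 := by
  rw [← coe_integers]
  exact Measure.addHaarMeasure_self

instance haar_isAddHaarMeasure : (haar p).IsAddHaarMeasure := by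
  unfold haar; infer_instance

instance haar_sigmaFinite : SigmaFinite (haar p) := by
  unfold haar; infer_instance

/-- `ℤ_p` is the disjoint union of the `p` cosets of `pℤ_p`. -/
theorem haar_ball_inv : haar p (Metric.closedBall 0 (p : ℝ)⁻¹) = (p : ℝ≥0∞)⁻¹ := by
  have hp : 0 < (p : ℝ) := by exact_mod_cast (Fact.out : p.Prime).pos
  have hp1 : (p : ℝ)⁻¹ < 1 := inv_lt_one_of_one_lt₀ (by exact_mod_cast (Fact.out : p.Prime).one_lt)
  have hU : Metric.closedBall (0 : ℚ_[p]) 1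
      = ⋃ i ∈ Finset.range p, Metric.closedBall (i : ℚ_[p]) (p : ℝ)⁻¹ := by
    ext x
    simp only [Metric.mem_closedBall, Set.mem_iUnion, Finset.mem_range, exists_prop,
      dist_eq_norm, sub_zero]
    constructor
    · exact fun hx => exists_natCast_near hx
    · rintro ⟨i, -, hi⟩
      have h1 := padic_norm_natCast_le_one (p := p) i
      calc ‖x‖ = ‖(x - i) + i‖ := by ring_nf
        _ ≤ max ‖x - i‖ ‖(i : ℚ_[p])‖ := Padic.nonarchimedean _ _
        _ ≤ 1 := max_le (hi.trans hp1.le) h1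
  have hd : Set.PairwiseDisjoint (↑(Finset.range p))
      (fun i : ℕ => Metric.closedBall (i : ℚ_[p]) (p : ℝ)⁻¹) := by
    intro i hi j hj hij
    rw [Function.onFun, Set.disjoint_left]
    intro x hx hx'
    simp only [Metric.mem_closedBall, dist_eq_norm] at hx hx'
    have h2 : ‖((i - j : ℤ) : ℚ_[p])‖ < 1 := by
      calc ‖((i - j : ℤ) : ℚ_[p])‖ = ‖(x - j) - (x - i)‖ := by push_cast; ring_nf
        _ ≤ max ‖x - j‖ ‖x - i‖ := padic_norm_sub_le _ _
        _ < 1 := (max_le hx' hx).trans_lt hp1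
    rw [Padic.norm_intCast_lt_one_iff] at h2
    have hi' := Finset.mem_range.1 hi
    have hj' := Finset.mem_range.1 hj
    have := Int.eq_zero_of_abs_lt_dvd h2 (by rw [abs_lt]; omega)
    omega
  have h1 := haar_unitBall (p := p)
  rw [hU, measure_biUnion_finset hd (fun i _ => Metric.isClosed_closedBall.measurableSet)] at h1
  have h3 : ∀ i : ℕ, haar p (Metric.closedBall (i : ℚ_[p]) (p : ℝ)⁻¹)
      = haar p (Metric.closedBall 0 (p : ℝ)⁻¹) := by
    intro i
    rw [← measure_preimage_add (haar p) (i : ℚ_[p]) (Metric.closedBall (i : ℚ_[p]) (p : ℝ)⁻¹)]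
    congr 1
    ext x
    simp [dist_eq_norm]
  simp only [h3, Finset.sum_const, Finset.card_range, nsmul_eq_mul] at h1
  rw [← ENNReal.eq_inv_of_mul_eq_one_left ((mul_comm _ _).trans h1)]

theorem measurableEmbedding_mul_left {c : ℚ_[p]} (hc : c ≠ 0) :
    MeasurableEmbedding (fun a : ℚ_[p] => c * a) :=
  (Homeomorph.mulLeft₀ c hc).measurableEmbedding

/-- By uniqueness of Haar measure, multiplication by `c` scales it by a constant, which can be read
off from a single set `B`. -/
theorem map_mul_haar {c : ℚ_[p]} (hc : c ≠ 0) {B : Set ℚ_[p]} {k : ℝ≥0∞}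
    (h0 : haar p B ≠ 0) (htop : haar p B ≠ ∞)
    (h : haar p ((fun a => c * a) ⁻¹' B) = k * haar p B) :
    (haar p).map (fun a => c * a) = k • haar p := by
  have hH : ((haar p).map (fun a => c * a)).IsAddHaarMeasure :=
    AddEquiv.isAddHaarMeasure_map (haar p) (DistribMulAction.toAddEquiv₀ ℚ_[p] c hc)
      (continuous_const.mul continuous_id) (continuous_const.mul continuous_id)
  have h2 := Measure.isAddLeftInvariant_eq_smul ((haar p).map (fun a => c * a)) (haar p)
  have h3 := congrArg (fun m => m B) h2
  simp only [(measurableEmbedding_mul_left hc).map_apply, Measure.smul_apply, h] at h3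
  rw [h2]
  have h4 : k = (((haar p).map (fun a => c * a)).addHaarScalarFactor (haar p) : ℝ≥0∞) := by
    rw [← ENNReal.mul_left_inj h0 htop, h3]
    rfl
  rw [h4]
  rfl

theorem map_unit_mul_haar {c : ℚ_[p]} (hc : ‖c‖ = 1) :
    (haar p).map (fun a => c * a) = haar p := by
  have hc0 : c ≠ 0 := by rintro rfl; simp at hc
  have := map_mul_haar (p := p) hc0 (B := Metric.closedBall 0 1) (k := 1)
    (by simp [haar_unitBall]) (by simp [haar_unitBall]) (by
      rw [one_mul]
      congr 1
      ext x
      simp [hc])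
  simpa using this

theorem map_prime_mul_haar :
    (haar p).map (fun a => (p : ℚ_[p]) * a) = (p : ℝ≥0∞) • haar p := by
  have hp := (Fact.out : p.Prime)
  have hp' : (0 : ℝ) < p := by exact_mod_cast hp.pos
  have hc0 : (p : ℚ_[p]) ≠ 0 := by exact_mod_cast hp.ne_zero
  refine map_mul_haar (p := p) hc0 (B := Metric.closedBall 0 (p : ℝ)⁻¹)
    (by simp [haar_ball_inv])
    (by simp [haar_ball_inv, hp.ne_zero]) ?_
  rw [haar_ball_inv, ENNReal.mul_inv_cancel (by simp [hp.ne_zero]) (by simp),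
    ← haar_unitBall (p := p)]
  congr 1
  ext x
  simp only [Set.mem_preimage, Metric.mem_closedBall, dist_zero_right, norm_mul, Padic.norm_p]
  rw [← div_eq_inv_mul, div_le_iff₀ hp', inv_mul_cancel₀ hp'.ne']

/-- The density of `localMeasure β p` with respect to Haar measure. -/
def localDensity (β : ℝ) (p : ℕ) [Fact p.Prime] (a : ℚ_[p]) : ℝ≥0∞ :=
  ENNReal.ofReal ((1 - (p : ℝ) ^ (-β)) / (1 - (p : ℝ) ^ (-1 : ℝ)) * ‖a‖ ^ (β - 1))

theorem localMeasure_apply (β : ℝ) {s : Set ℚ_[p]} (hs : MeasurableSet s) :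
    localMeasure β p s = ∫⁻ a in s, localDensity β p a ∂haar p :=
  withDensity_apply _ hs

theorem localDensity_mul (β : ℝ) (c a : ℚ_[p]) :
    localDensity β p (c * a) = ENNReal.ofReal (‖c‖ ^ (β - 1)) * localDensity β p a := by
  unfold localDensity
  rw [← ENNReal.ofReal_mul (by positivity), norm_mul,
    Real.mul_rpow (norm_nonneg _) (norm_nonneg _)]
  ring_nf

theorem localMeasure_preimage_mul_of_map (β : ℝ) {c : ℚ_[p]} (hc : c ≠ 0) {k : ℝ≥0∞}
    (h : (haar p).map (fun a => c * a) = k • haar p) {E : Set ℚ_[p]} (hE : MeasurableSet E) :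
    ENNReal.ofReal (‖c‖ ^ (β - 1)) * localMeasure β p ((fun a => c * a) ⁻¹' E)
      = k * localMeasure β p E := by
  have hm := measurableEmbedding_mul_left hc
  rw [localMeasure_apply β hE, localMeasure_apply β (hm.measurable hE),
    ← lintegral_const_mul' _ _ ENNReal.ofReal_ne_top]
  simp only [← localDensity_mul]
  rw [← smul_eq_mul, ← lintegral_smul_measure, ← Measure.restrict_smul, ← h,
    hm.restrict_map, hm.lintegral_map]

theorem localMeasure_preimage_unit_mul (β : ℝ) {c : ℚ_[p]} (hc : ‖c‖ = 1) {E : Set ℚ_[p]}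
    (hE : MeasurableSet E) :
    localMeasure β p ((fun a => c * a) ⁻¹' E) = localMeasure β p E := by
  have hc0 : c ≠ 0 := by rintro rfl; simp at hc
  have := localMeasure_preimage_mul_of_map β hc0 (k := 1) (by simpa using map_unit_mul_haar hc) hE
  simpa [hc] using this

/-- Multiplication by `p` scales `μ_{β,p}` by `p ^ β`. -/
theorem localMeasure_preimage_prime_mul (β : ℝ) {E : Set ℚ_[p]} (hE : MeasurableSet E) :
    localMeasure β p ((fun a => (p : ℚ_[p]) * a) ⁻¹' E)
      = ENNReal.ofReal ((p : ℝ) ^ β) * localMeasure β p E := by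
  have hp := (Fact.out : p.Prime)
  have hp' : (0 : ℝ) < p := by exact_mod_cast hp.pos
  have hc0 : (p : ℚ_[p]) ≠ 0 := by exact_mod_cast hp.ne_zero
  have := localMeasure_preimage_mul_of_map β hc0 map_prime_mul_haar hE
  rw [Padic.norm_p] at this
  have h1 : ENNReal.ofReal ((p : ℝ) ^ (β - 1)) * ENNReal.ofReal ((p : ℝ)⁻¹ ^ (β - 1)) = 1 := by
    rw [← ENNReal.ofReal_mul (by positivity), ← Real.mul_rpow hp'.le (by positivity),
      mul_inv_cancel₀ hp'.ne', Real.one_rpow, ENNReal.ofReal_one]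
  have h2 : ENNReal.ofReal ((p : ℝ) ^ β) = ENNReal.ofReal ((p : ℝ) ^ (β - 1)) * (p : ℝ≥0∞) := by
    rw [← ENNReal.ofReal_natCast, ← ENNReal.ofReal_mul (by positivity), Real.rpow_sub_one hp'.ne',
      div_mul_cancel₀ _ hp'.ne']
  rw [h2, mul_assoc, ← this, ← mul_assoc, h1, one_mul]

instance localMeasure_sigmaFinite (β : ℝ) : SigmaFinite (localMeasure β p) := by
  unfold localMeasure; infer_instance

theorem localMeasure_singleton_zero (β : ℝ) : localMeasure β p {0} = 0 := by
  refine withDensity_absolutelyContinuous _ _ ?_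
  simp

/-- The set of units of `ℤ_p`. -/
def unitSphere (p : ℕ) [Fact p.Prime] : Set ℚ_[p] := {x | ‖x‖ = 1}

theorem measurableSet_unitSphere : MeasurableSet (unitSphere p) :=
  (isClosed_eq continuous_norm continuous_const).measurableSet

theorem rpow_neg_lt_one {β : ℝ} (hβ : 0 < β) : (p : ℝ) ^ (-β) < 1 :=
  Real.rpow_lt_one_of_one_lt_of_neg (by exact_mod_cast (Fact.out : p.Prime).one_lt) (by linarith)

theorem haar_unitSphere : haar p (unitSphere p) = ENNReal.ofReal (1 - (p : ℝ) ^ (-1 : ℝ)) := by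
  have hp := (Fact.out : p.Prime)
  have hp' : (0 : ℝ) < p := by exact_mod_cast hp.pos
  have hp1 : (p : ℝ)⁻¹ < 1 := inv_lt_one_of_one_lt₀ (by exact_mod_cast hp.one_lt)
  have : unitSphere p = Metric.closedBall 0 1 \ Metric.closedBall 0 (p : ℝ)⁻¹ := by
    ext x
    simp only [unitSphere, Set.mem_ofPred_eq, Set.mem_sdiff, Metric.mem_closedBall, dist_zero_right]
    constructor
    · intro h; rw [h]; exact ⟨le_rfl, not_le.2 hp1⟩
    · rintro ⟨h1, h2⟩
      exact h1.antisymm (not_lt.1 fun h => h2 (padic_norm_le_inv_of_lt_one h))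
  rw [this, measure_sdiff (Metric.closedBall_subset_closedBall hp1.le)
    Metric.isClosed_closedBall.nullMeasurableSet (by simp [haar_ball_inv, hp.ne_zero]),
    haar_unitBall, haar_ball_inv, ENNReal.ofReal_sub _ (by positivity), Real.rpow_neg_one,
    ENNReal.ofReal_one, ENNReal.ofReal_inv_of_pos hp', ENNReal.ofReal_natCast]

theorem localMeasure_unitSphere (β : ℝ) (hβ : 0 < β) :
    localMeasure β p (unitSphere p) = ENNReal.ofReal (1 - (p : ℝ) ^ (-β)) := by
  have h1 : 0 < 1 - (p : ℝ) ^ (-1 : ℝ) := sub_pos.2 (rpow_neg_lt_one one_pos)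
  have h2 : 0 < 1 - (p : ℝ) ^ (-β) := sub_pos.2 (rpow_neg_lt_one hβ)
  rw [localMeasure_apply β measurableSet_unitSphere, setLIntegral_congr_fun
    (g := fun _ => ENNReal.ofReal ((1 - (p : ℝ) ^ (-β)) / (1 - (p : ℝ) ^ (-1 : ℝ))))
    measurableSet_unitSphere (fun a ha => ?_)]
  · rw [setLIntegral_const, haar_unitSphere, ← ENNReal.ofReal_mul (by positivity),
      div_mul_cancel₀ _ h1.ne']
  · rw [unitSphere, Set.mem_ofPred_eq] at ha
    simp [localDensity, ha]

/-- `ℤ_p ∖ {0}` is the disjoint union of the sets `p ^ k ℤ_p^*`, whose measures form a geometric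
series. -/
theorem localMeasure_integers (β : ℝ) (hβ : 0 < β) :
    localMeasure β p (PadicInt.subring p) = 1 := by
  have hp := (Fact.out : p.Prime)
  have hp' : (0 : ℝ) < p := by exact_mod_cast hp.pos
  have hp1 : (1 : ℝ) < p := by exact_mod_cast hp.one_lt
  have hc0 : (p : ℚ_[p]) ≠ 0 := by exact_mod_cast hp.ne_zero
  have h2 : 0 < 1 - (p : ℝ) ^ (-β) := sub_pos.2 (rpow_neg_lt_one hβ)
  -- `A k` is the sphere `p ^ k ℤ_p^*`.
  let A : ℕ → Set ℚ_[p] := fun k => {x | ‖x‖ = (p : ℝ) ^ (-(k : ℤ))}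
  have hA : ∀ k, MeasurableSet (A k) := fun k =>
    (isClosed_eq continuous_norm continuous_const).measurableSet
  have hAm : ∀ k, localMeasure β p (A k)
      = ENNReal.ofReal (1 - (p : ℝ) ^ (-β)) * ENNReal.ofReal ((p : ℝ) ^ (-β)) ^ k := by
    intro k
    induction k with
    | zero =>
      rw [pow_zero, mul_one, ← localMeasure_unitSphere β hβ]
      simp [A, unitSphere]
    | succ k ih =>
      have h := localMeasure_preimage_prime_mul β (hA (k + 1))
      have h' : (fun a => (p : ℚ_[p]) * a) ⁻¹' A (k + 1) = A k := by
        ext x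
        simp only [A, Set.mem_preimage, Set.mem_ofPred_eq, norm_mul, Padic.norm_p]
        rw [inv_mul_eq_iff_eq_mul₀ hp'.ne', ← zpow_one_add₀ hp'.ne']
        push_cast
        ring_nf
      rw [h', ih] at h
      rw [pow_succ, ← mul_assoc, h, mul_comm, ← mul_assoc, ← ENNReal.ofReal_mul (by positivity),
        ← Real.rpow_add hp']
      simp
  have hU : (PadicInt.subring p : Set ℚ_[p]) = {0} ∪ ⋃ k, A k := by
    ext x
    simp only [coe_integers, Metric.mem_closedBall, dist_zero_right, Set.mem_union,
      Set.mem_singleton_iff, Set.mem_iUnion, A, Set.mem_ofPred_eq]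
    constructor
    · intro hx
      by_cases h0 : x = 0
      · exact Or.inl h0
      · right
        let y : ℤ_[p] := ⟨x, hx⟩
        have hy : y ≠ 0 := fun h => h0 (congrArg Subtype.val h)
        exact ⟨_, PadicInt.norm_eq_zpow_neg_valuation hy⟩
    · rintro (rfl | ⟨k, hk⟩)
      · simp
      · rw [hk]
        exact zpow_le_one_of_nonpos₀ hp1.le (by simp)
  have hdisj : Disjoint ({0} : Set ℚ_[p]) (⋃ k, A k) := by
    rw [Set.disjoint_singleton_left]
    simp only [Set.mem_iUnion, A, Set.mem_ofPred_eq, not_exists, norm_zero]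
    intro k
    exact (zpow_pos hp' _).ne
  have hpd : Pairwise (Function.onFun Disjoint A) := by
    intro i j hij
    rw [Function.onFun, Set.disjoint_left]
    intro x hx hx'
    simp only [A, Set.mem_ofPred_eq] at hx hx'
    have := zpow_right_injective₀ hp' hp1.ne' (hx.symm.trans hx')
    omega
  rw [hU, measure_union hdisj (MeasurableSet.iUnion hA), localMeasure_singleton_zero, zero_add,
    measure_iUnion hpd hA]
  simp only [hAm]
  rw [ENNReal.tsum_mul_left, ENNReal.tsum_geometric, ENNReal.ofReal_sub _ (by positivity),
    ENNReal.ofReal_one, ENNReal.mul_inv_cancel]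
  · rw [← ENNReal.ofReal_one, ← ENNReal.ofReal_sub _ (by positivity)]
    simpa using h2
  · exact ENNReal.sub_ne_top ENNReal.one_ne_top

end Local

/-! ### Cosets, boxes and the product measure -/

/-- The set of adeles with `p`-th component in `E p` for all `p`. -/
def box (E : ∀ p : PrimeIndex, Set ℚ_[(p : ℕ)]) : Set Adeles := {x | ∀ p, x p ∈ E p}

/-- The coset `x + N ∏_p ℤ_p`. -/
def adeleBall (x : Adeles) (N : ℚ) : Set Adeles :=
  {y | ∀ p : PrimeIndex, ‖y p - x p‖ ≤ ‖(N : ℚ_[(p : ℕ)])‖}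

theorem isOpen_integers (p : PrimeIndex) : IsOpen (PadicInt.subring (p : ℕ) : Set ℚ_[(p : ℕ)]) := by
  rw [coe_integers]
  exact IsUltrametricDist.isOpen_closedBall _ one_ne_zero

instance fact_isOpen_integers :
    Fact (∀ p : PrimeIndex, IsOpen (PadicInt.subring (p : ℕ) : Set ℚ_[(p : ℕ)])) :=
  ⟨isOpen_integers⟩

theorem adeleBall_eq_of_mem {x y : Adeles} {N : ℚ} (h : y ∈ adeleBall x N) :
    adeleBall y N = adeleBall x N := by
  ext z
  constructor
  · intro hz p
    have := Padic.nonarchimedean (z p - y p) (y p - x p)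
    rw [sub_add_sub_cancel] at this
    exact this.trans (max_le (hz p) (h p))
  · intro hz p
    have := padic_norm_sub_le (z p - x p) (y p - x p)
    rw [sub_sub_sub_cancel_right] at this
    exact this.trans (max_le (hz p) (h p))

theorem norm_cast_le_of_dvd {m n : ℕ} (h : m ∣ n) (p : ℕ) [Fact p.Prime] :
    ‖(n : ℚ_[p])‖ ≤ ‖(m : ℚ_[p])‖ := by
  obtain ⟨k, rfl⟩ := h
  rw [Nat.cast_mul, norm_mul]
  exact mul_le_of_le_one_right (norm_nonneg _) (padic_norm_natCast_le_one k)

theorem adeleBall_subset_of_dvd (x : Adeles) {m n : ℕ} (h : m ∣ n) :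
    adeleBall x n ⊆ adeleBall x m := by
  intro y hy p
  exact (hy p).trans (by simpa using norm_cast_le_of_dvd h (p : ℕ))

/-- A positive integer of prescribed smallness at finitely many primes. -/
theorem exists_nat_norm_lt (I : Finset PrimeIndex) {ε : PrimeIndex → ℝ} (hε : ∀ p ∈ I, 0 < ε p) :
    ∃ N : ℕ, N ≠ 0 ∧ ∀ p ∈ I, ‖(N : ℚ_[(p : ℕ)])‖ < ε p := by
  have h : ∀ p : PrimeIndex, ∃ k : ℕ, p ∈ I → ‖(((p : ℕ) ^ k : ℕ) : ℚ_[(p : ℕ)])‖ < ε p := by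
    intro p
    by_cases hp : p ∈ I
    · obtain ⟨k, hk⟩ := exists_pow_lt_of_lt_one (hε p hp) (Padic.norm_p_lt_one (p := (p : ℕ)))
      exact ⟨k, fun _ => by simpa using hk⟩
    · exact ⟨0, fun h => absurd h hp⟩
  choose k hk using h
  refine ⟨∏ p ∈ I, (p : ℕ) ^ k p,
    Finset.prod_ne_zero_iff.2 fun p _ => pow_ne_zero _ p.2.ne_zero, ?_⟩
  intro p hp
  exact (norm_cast_le_of_dvd (Finset.dvd_prod_of_mem (fun p : PrimeIndex => (p : ℕ) ^ k p) hp)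
    (p : ℕ)).trans_lt (hk p hp)

theorem finite_not_integral (x : Adeles) : {p : PrimeIndex | ¬ ‖x p‖ ≤ 1}.Finite := by
  have := x.2
  rw [Filter.eventually_cofinite] at this
  exact this

/-- The cosets `x + N ∏_p ℤ_p` are a neighbourhood basis of `x`. -/
theorem exists_adeleBall_subset {U : Set Adeles} (hU : IsOpen U) {x : Adeles} (hx : x ∈ U) :
    ∃ N : ℕ, N ≠ 0 ∧ adeleBall x N ⊆ U := by
  -- On the open set of adeles integral at the primes of `S`, which contains `x`, the topology is
  -- induced from `∏_p ℚ_p`.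
  let S : Set PrimeIndex := {p | ‖x p‖ ≤ 1}
  have hS : Filter.cofinite ≤ Filter.principal S := by
    rw [Filter.le_principal_iff]
    exact x.2
  let inc := RestrictedProduct.inclusion (fun p : PrimeIndex => ℚ_[(p : ℕ)])
    (fun p => (PadicInt.subring (p : ℕ) : Set ℚ_[(p : ℕ)])) hS
  have hV : IsOpen (inc ⁻¹' U) := hU.preimage (RestrictedProduct.continuous_inclusion hS)
  rw [RestrictedProduct.isEmbedding_coe_of_principal.isOpen_iff] at hV
  obtain ⟨V, hV, hVU⟩ := hV
  have hmem : ∀ y : Adeles, (∀ p ∈ S, ‖y p‖ ≤ 1) → ((fun p => y p) ∈ V ↔ y ∈ U) := by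
    intro y hy
    have := Set.ext_iff.1 hVU ⟨fun p => y p, hy⟩
    exact this
  have hxV : (fun p => x p) ∈ V := (hmem x fun p hp => hp).2 hx
  obtain ⟨I, u, hu, hI⟩ := isOpen_pi_iff.1 hV _ hxV
  have hε : ∀ p : PrimeIndex, ∃ ε : ℝ, p ∈ I → 0 < ε ∧ Metric.ball (x p) ε ⊆ u p := by
    intro p
    by_cases hp : p ∈ I
    · obtain ⟨ε, h1, h2⟩ := Metric.isOpen_iff.1 (hu p hp).1 _ (hu p hp).2
      exact ⟨ε, fun _ => ⟨h1, h2⟩⟩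
    · exact ⟨0, fun h => absurd h hp⟩
  choose ε hε using hε
  obtain ⟨N, hN, h⟩ := exists_nat_norm_lt I (fun p hp => (hε p hp).1)
  refine ⟨N, hN, fun y hy => (hmem y ?_).1 (hI ?_)⟩
  · intro p hp
    have h1 := Padic.nonarchimedean (y p - x p) (x p)
    rw [sub_add_cancel] at h1
    refine h1.trans (max_le ((hy p).trans ?_) hp)
    simpa using Padic.norm_int_le_one (p := p) N
  · intro p hp
    refine (hε p hp).2 ?_
    rw [Metric.mem_ball, dist_eq_norm]
    exact (hy p).trans_lt (by simpa using h p hp)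

theorem norm_prime_of_ne {p : PrimeIndex} {l : ℕ} (hl : l.Prime) (h : (p : ℕ) ≠ l) :
    ‖(l : ℚ_[(p : ℕ)])‖ = 1 := by
  rw [Padic.norm_natCast_eq_one_iff]
  exact (Nat.coprime_primes p.2 hl).2 h

theorem diag_apply (q : ℚ) (p : PrimeIndex) : diag q p = (q : ℚ_[(p : ℕ)]) := rfl

/-- An integral adele is congruent to a natural number modulo any positive integer. By induction on
the number of prime factors of the modulus, this reduces to the residue field of a single `ℤ_p`. -/
theorem exists_nat_near {N : ℕ} (hN : N ≠ 0) {x : Adeles} (hx : ∀ p, ‖x p‖ ≤ 1) :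
    ∃ a : ℕ, ∀ p : PrimeIndex, ‖x p - (a : ℚ_[(p : ℕ)])‖ ≤ ‖(N : ℚ_[(p : ℕ)])‖ := by
  induction N using Nat.recOnMul generalizing x with
  | zero => exact absurd rfl hN
  | one => exact ⟨0, fun p => by simpa using hx p⟩
  | prime l hl =>
    obtain ⟨q, rfl⟩ : ∃ q : PrimeIndex, (q : ℕ) = l := ⟨⟨l, hl⟩, rfl⟩
    obtain ⟨a, -, ha⟩ := exists_natCast_near (hx q)
    refine ⟨a, fun p => ?_⟩
    by_cases hp : (p : ℕ) = q
    · obtain rfl : p = q := Subtype.ext hp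
      simpa using ha
    · rw [norm_prime_of_ne hl hp]
      exact (padic_norm_sub_le _ _).trans
        (max_le (hx p) (padic_norm_natCast_le_one a))
  | mul m n hm hn =>
    have hm0 : m ≠ 0 := left_ne_zero_of_mul hN
    obtain ⟨a, ha⟩ := hm hm0 hx
    -- If `x ≡ a mod m` and `(x - a) / m ≡ b mod n`, then `x ≡ a + m b mod m n`.
    have hy : ∀ p : PrimeIndex,
        (diag (m : ℚ)⁻¹ * (x - diag a)) p = (m : ℚ_[(p : ℕ)])⁻¹ * (x p - a) := by
      intro p
      change ((((m : ℚ)⁻¹ : ℚ) : ℚ_[(p : ℕ)])) * (x p - ((a : ℚ) : ℚ_[(p : ℕ)])) = _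
      push_cast
      rfl
    have hmp : ∀ p : PrimeIndex, (m : ℚ_[(p : ℕ)]) ≠ 0 := fun p => by exact_mod_cast hm0
    obtain ⟨b, hb⟩ := hn (right_ne_zero_of_mul hN) (x := diag (m : ℚ)⁻¹ * (x - diag a)) (by
      intro p
      rw [hy, norm_mul, norm_inv, inv_mul_le_iff₀ (norm_pos_iff.2 (hmp p)), mul_one]
      exact ha p)
    refine ⟨a + m * b, fun p => ?_⟩
    have h1 : x p - ((a + m * b : ℕ) : ℚ_[(p : ℕ)])
        = m * ((diag (m : ℚ)⁻¹ * (x - diag a)) p - b) := by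
      rw [hy, mul_sub, mul_inv_cancel_left₀ (hmp p)]
      push_cast
      ring
    rw [h1, norm_mul, Nat.cast_mul, norm_mul]
    exact mul_le_mul_of_nonneg_left (hb p) (norm_nonneg _)

/-- A suitable positive integer multiple of an adele is integral. -/
theorem exists_nat_mul_integral (x : Adeles) :
    ∃ m : ℕ, m ≠ 0 ∧ ∀ p : PrimeIndex, ‖(m : ℚ_[(p : ℕ)]) * x p‖ ≤ 1 := by
  have hpos : ∀ p ∈ (finite_not_integral x).toFinset, 0 < ‖x p‖⁻¹ := by
    intro p hp
    rw [Set.Finite.mem_toFinset, Set.mem_ofPred_eq, not_le] at hp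
    exact inv_pos.2 (one_pos.trans hp)
  obtain ⟨m, hm, h⟩ := exists_nat_norm_lt _ hpos
  refine ⟨m, hm, fun p => ?_⟩
  rw [norm_mul]
  by_cases hp : ‖x p‖ ≤ 1
  · exact mul_le_one₀ (padic_norm_natCast_le_one m) (norm_nonneg _) hp
  · have h2 := h p (by simpa using hp)
    have h3 : 0 < ‖x p‖ := one_pos.trans (not_le.1 hp)
    calc _ ≤ ‖x p‖⁻¹ * ‖x p‖ := mul_le_mul_of_nonneg_right h2.le h3.le
      _ = 1 := inv_mul_cancel₀ h3.ne'

theorem mem_adeleBall_diag {r N : ℚ} {x : Adeles} :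
    x ∈ adeleBall (diag r) N ↔ ∀ p : PrimeIndex, ‖x p - (r : ℚ_[(p : ℕ)])‖ ≤ ‖(N : ℚ_[(p : ℕ)])‖ :=
  Iff.rfl

/-- The rationals are dense in the finite adeles. -/
theorem exists_rat_near (x : Adeles) {N : ℕ} (hN : N ≠ 0) : ∃ r : ℚ, x ∈ adeleBall (diag r) N := by
  obtain ⟨m, hm, h⟩ := exists_nat_mul_integral x
  have hx : ∀ p, (diag (m : ℚ) * x) p = (m : ℚ_[(p : ℕ)]) * x p := by
    intro p
    change (((m : ℚ) : ℚ_[(p : ℕ)])) * x p = _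
    push_cast
    rfl
  obtain ⟨a, ha⟩ := exists_nat_near (mul_ne_zero hm hN) (x := diag (m : ℚ) * x)
    (fun p => by rw [hx]; exact h p)
  refine ⟨a / m, fun p => ?_⟩
  have hmp : (m : ℚ_[(p : ℕ)]) ≠ 0 := by exact_mod_cast hm
  have h1 := ha p
  have h2 : (m : ℚ_[(p : ℕ)]) * x p - a = m * (x p - (a / m)) := by
    rw [mul_sub, mul_div_cancel₀ _ hmp]
  rw [hx, h2, Nat.cast_mul, norm_mul, norm_mul] at h1
  have h3 := le_of_mul_le_mul_left h1 (norm_pos_iff.2 hmp)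
  rw [diag_apply]
  push_cast
  exact h3

/-- The cosets of the groups `k! ∏_p ℤ_p`, each with a rational representative. Using only
factorials as moduli makes any two of these sets nested or disjoint; using rational representatives makes them
countable in number. -/
def rationalBalls : Set (Set Adeles) :=
  Set.range fun rk : ℚ × ℕ => adeleBall (diag rk.1) (rk.2.factorial : ℕ)

theorem isPiSystem_rationalBalls : IsPiSystem rationalBalls := by
  have key : ∀ (r s : ℚ) (k l : ℕ), k ≤ l →
      (adeleBall (diag r) (k.factorial : ℕ) ∩ adeleBall (diag s) (l.factorial : ℕ)).Nonempty →
      adeleBall (diag s) (l.factorial : ℕ) ⊆ adeleBall (diag r) (k.factorial : ℕ) := by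
    rintro r s k l hkl ⟨x, hx, hx'⟩
    rw [← adeleBall_eq_of_mem hx, ← adeleBall_eq_of_mem hx']
    exact adeleBall_subset_of_dvd x (Nat.factorial_dvd_factorial hkl)
  rintro _ ⟨⟨r, k⟩, rfl⟩ _ ⟨⟨s, l⟩, rfl⟩ h
  rcases le_total k l with hkl | hkl
  · exact ⟨⟨s, l⟩, (Set.inter_eq_right.2 (key r s k l hkl h)).symm⟩
  · exact ⟨⟨r, k⟩, (Set.inter_eq_left.2 (key s r l k hkl (Set.inter_comm _ _ ▸ h))).symm⟩

theorem measurableSet_box {E : ∀ p : PrimeIndex, Set ℚ_[(p : ℕ)]} (hE : ∀ p, MeasurableSet (E p)) :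
    MeasurableSet (box E) := by
  have : box E = ⋂ p, (fun x : Adeles => x p) ⁻¹' E p := by ext; simp [box]
  rw [this]
  exact MeasurableSet.iInter fun p => (RestrictedProduct.continuous_eval p).measurable (hE p)

theorem adeleBall_eq_box (x : Adeles) (N : ℚ) :
    adeleBall x N = box fun p => Metric.closedBall (x p) ‖(N : ℚ_[(p : ℕ)])‖ := by
  ext y
  simp only [adeleBall, box, Set.mem_ofPred_eq, Metric.mem_closedBall, dist_eq_norm]

theorem measurableSet_adeleBall (x : Adeles) (N : ℚ) : MeasurableSet (adeleBall x N) := by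
  rw [adeleBall_eq_box]
  exact measurableSet_box fun p => Metric.isClosed_closedBall.measurableSet

theorem measurableSpace_eq_generateFrom :
    adelesMeasurableSpace = MeasurableSpace.generateFrom rationalBalls := by
  apply le_antisymm
  · refine MeasurableSpace.generateFrom_le fun U hU => ?_
    have h : U = ⋃ rk ∈ {rk : ℚ × ℕ | adeleBall (diag rk.1) (rk.2.factorial : ℕ) ⊆ U},
        adeleBall (diag rk.1) (rk.2.factorial : ℕ) := by
      apply Set.Subset.antisymm
      · intro x hx
        obtain ⟨N, hN, h⟩ := exists_adeleBall_subset hU hx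
        obtain ⟨r, hr⟩ := exists_rat_near x N.factorial_ne_zero
        refine Set.mem_biUnion (x := (r, N)) ?_ hr
        change adeleBall (diag r) (N.factorial : ℕ) ⊆ U
        rw [← adeleBall_eq_of_mem hr]
        exact (adeleBall_subset_of_dvd x (Nat.dvd_factorial (Nat.pos_of_ne_zero hN) le_rfl)).trans h
      · exact Set.iUnion₂_subset fun rk h => h
    rw [h]
    refine MeasurableSet.biUnion (Set.to_countable _) fun rk _ => ?_
    exact MeasurableSpace.measurableSet_generateFrom ⟨rk, rfl⟩
  · refine MeasurableSpace.generateFrom_le ?_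
    rintro _ ⟨rk, rfl⟩
    exact measurableSet_adeleBall _ _

/-- Two measures agreeing on the rational balls are equal if they are finite on these balls. -/
theorem ext_of_rationalBalls {μ ν : Measure Adeles}
    (hfin : ∀ (r : ℚ) {N : ℕ}, N ≠ 0 → μ (adeleBall (diag r) N) < ∞)
    (h : ∀ (r : ℚ) (k : ℕ), μ (adeleBall (diag r) (k.factorial : ℕ))
      = ν (adeleBall (diag r) (k.factorial : ℕ))) : μ = ν := by
  refine Measure.ext_of_generateFrom_of_cover_subset measurableSpace_eq_generateFrom
    isPiSystem_rationalBalls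
    (T := Set.range fun r : ℚ => adeleBall (diag r) ((Nat.factorial 0 : ℕ) : ℚ)) ?_
    (Set.countable_range _) ?_ ?_ ?_
  · rintro _ ⟨r, rfl⟩
    exact ⟨(r, 0), rfl⟩
  · refine Set.eq_univ_of_forall fun x => ?_
    obtain ⟨r, hr⟩ := exists_rat_near x (Nat.factorial_ne_zero 0)
    exact ⟨_, ⟨r, rfl⟩, hr⟩
  · rintro _ ⟨r, rfl⟩
    exact (hfin r (Nat.factorial_ne_zero 0)).ne
  · rintro _ ⟨⟨r, k⟩, rfl⟩
    exact h r k

/-- The inclusion of `ℤ_p` in `ℚ_p`. -/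
def padicIntCoe (p : ℕ) [Fact p.Prime] (x : ℤ_[p]) : ℚ_[p] := x

theorem measurableEmbedding_padicIntCoe (p : ℕ) [Fact p.Prime] :
    MeasurableEmbedding (padicIntCoe p) := by
  have h : Topology.IsOpenEmbedding (padicIntCoe p) := PadicInt.isOpenEmbedding_coe
  exact h.measurableEmbedding

theorem measurable_glue (S : Finset PrimeIndex) : Measurable (glue S) := by
  rw [measurableSpace_eq_generateFrom]
  refine measurable_generateFrom ?_
  rintro _ ⟨rk, rfl⟩
  change MeasurableSet (glue S ⁻¹' adeleBall (diag rk.1) (rk.2.factorial : ℕ))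
  rw [adeleBall_eq_box]
  have : ∀ p : PrimeIndex, Measurable fun y => glue S y p := by
    intro p
    by_cases hp : p ∈ S
    · have : (fun y => glue S y p) = fun y => y.1 ⟨p, hp⟩ := by
        funext y; exact dif_pos hp
      rw [this]
      exact (measurable_pi_apply _).comp measurable_fst
    · have : (fun y => glue S y p) = fun y => padicIntCoe (p : ℕ) (y.2 ⟨p, hp⟩) := by
        funext y; exact dif_neg hp
      rw [this]
      exact (measurableEmbedding_padicIntCoe (p : ℕ)).measurable.comp
        ((measurable_pi_apply _).comp measurable_snd)
  refine MeasurableSet.congr (MeasurableSet.iInter fun p => this p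
    (Metric.isClosed_closedBall (x := diag rk.1 p)
      (ε := ‖(((rk.2.factorial : ℕ) : ℚ) : ℚ_[(p : ℕ)])‖)).measurableSet) ?_
  ext y
  simp [box]

theorem integralPart_preimage {p : ℕ} [Fact p.Prime] (ν : Measure ℚ_[p]) (s : Set ℚ_[p]) :
    integralPart ν (padicIntCoe p ⁻¹' s) = ν (s ∩ PadicInt.subring p) := by
  change Measure.comap (padicIntCoe p) ν _ = _
  rw [(measurableEmbedding_padicIntCoe p).comap_apply, Set.image_preimage_eq_inter_range]
  congr 2
  exact Subtype.range_coe

theorem isProbabilityMeasure_integralPart {p : ℕ} [Fact p.Prime] {ν : Measure ℚ_[p]}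
    (hν : ν (PadicInt.subring p) = 1) : IsProbabilityMeasure (integralPart ν) :=
  ⟨by
    have := integralPart_preimage ν Set.univ
    rwa [Set.preimage_univ, Set.univ_inter, hν] at this⟩

/-- The measure of a box for a product measure. The terms of the sum defining `productMeasure` are
those of the expansion of `∏ p ∈ T, (ν p (E p ∖ ℤ_p) + ν p (E p ∩ ℤ_p))`. -/
theorem productMeasure_box (ν : ∀ p : PrimeIndex, Measure ℚ_[(p : ℕ)]) [∀ p, SigmaFinite (ν p)]
    (hν : ∀ p, ν p (PadicInt.subring (p : ℕ)) = 1) {E : ∀ p : PrimeIndex, Set ℚ_[(p : ℕ)]}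
    (hE : ∀ p, MeasurableSet (E p)) (T : Finset PrimeIndex)
    (hT : ∀ p ∉ T, E p = PadicInt.subring (p : ℕ)) :
    productMeasure ν (box E) = ∏ p ∈ T, ν p (E p) := by
  classical
  have hprob : ∀ p : PrimeIndex, IsProbabilityMeasure (integralPart (ν p)) := fun p =>
    isProbabilityMeasure_integralPart (hν p)
  have hZ : ∀ p : PrimeIndex, MeasurableSet (PadicInt.subring (p : ℕ) : Set ℚ_[(p : ℕ)]) :=
    fun p => (isOpen_integers p).measurableSet
  have hterm : ∀ S : Finset PrimeIndex,
      Measure.map (glue S) ((Measure.pi fun p : {p : PrimeIndex // p ∈ S} => (ν p).restrict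
          (PadicInt.subring ((p : PrimeIndex) : ℕ) : Set ℚ_[((p : PrimeIndex) : ℕ)])ᶜ).prod
        (Measure.infinitePi fun p : {p : PrimeIndex // p ∉ S} => integralPart (ν p))) (box E)
      = (∏ p ∈ S, ν p (E p \ PadicInt.subring (p : ℕ)))
        * ∏ p ∈ T \ S, ν p (E p ∩ PadicInt.subring (p : ℕ)) := by
    intro S
    have hpre : glue S ⁻¹' box E = (Set.univ.pi fun p : {p : PrimeIndex // p ∈ S} => E p) ×ˢ
        ((T.subtype (· ∉ S) : Set {p : PrimeIndex // p ∉ S}).pi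
          fun p => padicIntCoe ((p : PrimeIndex) : ℕ) ⁻¹' E p) := by
      ext y
      simp only [Set.mem_preimage, box, Set.mem_ofPred_eq, Set.mem_prod, Set.mem_pi, Set.mem_univ,
        true_imp_iff, Finset.mem_coe, Finset.mem_subtype]
      constructor
      · intro h
        refine ⟨fun p => ?_, fun p _ => ?_⟩
        · have := h p
          rwa [show glue S y p = y.1 p from dif_pos p.2] at this
        · have := h p
          rwa [show glue S y p = y.2 p from dif_neg p.2] at this
      · rintro ⟨h1, h2⟩ p
        by_cases hp : p ∈ S
        · rw [show glue S y p = y.1 ⟨p, hp⟩ from dif_pos hp]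
          exact h1 ⟨p, hp⟩
        · rw [show glue S y p = y.2 ⟨p, hp⟩ from dif_neg hp]
          by_cases hpT : p ∈ T
          · exact h2 ⟨p, hp⟩ hpT
          · rw [hT p hpT]
            exact (y.2 ⟨p, hp⟩).2
    rw [Measure.map_apply (measurable_glue S) (measurableSet_box hE), hpre, Measure.prod_prod,
      Measure.pi_pi, Measure.infinitePi_pi (fun p : {p : PrimeIndex // p ∉ S} => integralPart (ν p))
        (fun p _ => (measurableEmbedding_padicIntCoe _).measurable (hE p))]
    congr 1
    · rw [← Finset.prod_coe_sort S]
      refine Finset.prod_congr rfl fun p _ => ?_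
      rw [Measure.restrict_apply (hE p), Set.sdiff_eq]
    · rw [Finset.prod_subtype_eq_prod_filter
          (f := fun p : PrimeIndex => integralPart (ν p) (padicIntCoe (p : ℕ) ⁻¹' E p)),
        Finset.sdiff_eq_filter]
      exact Finset.prod_congr rfl fun p _ => integralPart_preimage (ν p) (E p)
  rw [productMeasure, Measure.sum_apply _ (measurableSet_box hE)]
  simp only [hterm]
  rw [tsum_eq_sum (s := T.powerset), ← Finset.prod_add]
  · refine Finset.prod_congr rfl fun p _ => ?_
    rw [add_comm]
    exact measure_inter_add_sdiff _ (hZ p)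
  · -- A prime `p ∈ S` outside `T` contributes the factor `ν p (ℤ_p ∖ ℤ_p) = 0`.
    intro S hS
    rw [Finset.mem_powerset, Finset.not_subset] at hS
    obtain ⟨p, hpS, hpT⟩ := hS
    rw [Finset.prod_eq_zero hpS, zero_mul]
    rw [hT p hpT, Set.sdiff_self, measure_empty]

/-! ### Scaling of the measure under positive rationals -/

theorem localMeasure_closedBall_lt_top {β : ℝ} (hβ : 0 < β) {p : ℕ} [Fact p.Prime] (c : ℚ_[p])
    (R : ℝ) : localMeasure β p (Metric.closedBall c R) < ∞ := by
  have hp := (Fact.out : p.Prime)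
  have hp' : (0 : ℝ) < p := by exact_mod_cast hp.pos
  have hp1 : (1 : ℝ) < p := by exact_mod_cast hp.one_lt
  have h : ∀ k : ℕ, localMeasure β p (Metric.closedBall 0 ((p : ℝ) ^ k)) < ∞ := by
    intro k
    induction k with
    | zero => rw [pow_zero, ← coe_integers, localMeasure_integers β hβ]; exact ENNReal.one_lt_top
    | succ k ih =>
      have h' : Metric.closedBall (0 : ℚ_[p]) ((p : ℝ) ^ (k + 1))
          = (fun a => (p : ℚ_[p]) * a) ⁻¹' Metric.closedBall 0 ((p : ℝ) ^ k) := by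
        ext x
        simp only [Set.mem_preimage, Metric.mem_closedBall, dist_zero_right, norm_mul, Padic.norm_p]
        rw [inv_mul_le_iff₀ hp', pow_succ']
      rw [h', localMeasure_preimage_prime_mul β Metric.isClosed_closedBall.measurableSet]
      exact ENNReal.mul_lt_top ENNReal.ofReal_lt_top ih
  obtain ⟨k, hk⟩ := pow_unbounded_of_one_lt (R + ‖c‖) hp1
  refine (measure_mono ?_).trans_lt (h k)
  refine Metric.closedBall_subset_closedBall' ?_
  rw [dist_zero_right]
  exact hk.le

theorem adelicMeasure_box {β : ℝ} (hβ : 0 < β) {E : ∀ p : PrimeIndex, Set ℚ_[(p : ℕ)]}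
    (hE : ∀ p, MeasurableSet (E p)) (T : Finset PrimeIndex)
    (hT : ∀ p ∉ T, E p = PadicInt.subring (p : ℕ)) :
    adelicMeasure β (box E) = ∏ p ∈ T, localMeasure β (p : ℕ) (E p) :=
  productMeasure_box _ (fun _ => localMeasure_integers β hβ) hE T hT

theorem exists_finset_closedBall (r : ℚ) {N : ℕ} (hN : N ≠ 0) :
    ∃ T : Finset PrimeIndex, ∀ p ∉ T,
      Metric.closedBall (diag r p) ‖((N : ℚ) : ℚ_[(p : ℕ)])‖ = PadicInt.subring (p : ℕ) := by
  refine ⟨(finite_not_integral (diag r)).toFinset ∪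
    (finite_not_integral (diag (N : ℚ)⁻¹)).toFinset, fun p hp => ?_⟩
  simp only [Finset.mem_union, Set.Finite.mem_toFinset, Set.mem_ofPred_eq, not_or, not_not] at hp
  obtain ⟨h1, h2⟩ := hp
  have hNp : (N : ℚ_[(p : ℕ)]) ≠ 0 := by exact_mod_cast hN
  have h3 : ‖((N : ℚ) : ℚ_[(p : ℕ)])‖ = 1 := by
    rw [diag_apply] at h2
    push_cast at h2 ⊢
    refine le_antisymm (padic_norm_natCast_le_one N) ?_
    rwa [norm_inv, inv_le_one₀ (norm_pos_iff.2 hNp)] at h2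
  rw [h3, coe_integers]
  exact (IsUltrametricDist.closedBall_eq_of_mem (by simpa using h1)).symm

theorem adelicMeasure_ball_lt_top {β : ℝ} (hβ : 0 < β) (r : ℚ) {N : ℕ} (hN : N ≠ 0) :
    adelicMeasure β (adeleBall (diag r) N) < ∞ := by
  obtain ⟨T, hT⟩ := exists_finset_closedBall r hN
  rw [adeleBall_eq_box,
    adelicMeasure_box hβ (fun p => Metric.isClosed_closedBall.measurableSet) T hT]
  exact ENNReal.prod_lt_top fun p _ => localMeasure_closedBall_lt_top hβ _ _

theorem smul_apply (g : PosRat) (x : Adeles) (p : PrimeIndex) :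
    (g • x) p = ((g : ℚ) : ℚ_[(p : ℕ)]) * x p := rfl

theorem measurable_smul (g : PosRat) : Measurable fun x : Adeles => g • x :=
  (continuous_const.mul continuous_id : Continuous fun x : Adeles => diag (g : ℚ) * x).measurable

/-- A positive natural number as a positive rational. -/
def posNat (n : ℕ) (hn : n ≠ 0) : PosRat := ⟨n, by exact_mod_cast Nat.pos_of_ne_zero hn⟩

theorem posNat_smul_apply {n : ℕ} (hn : n ≠ 0) (x : Adeles) (p : PrimeIndex) :
    (posNat n hn • x) p = (n : ℚ_[(p : ℕ)]) * x p := by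
  rw [smul_apply]
  congr 1

theorem adelicMeasure_preimage_prime_ball {β : ℝ} (hβ : 0 < β) (q : PrimeIndex) (r : ℚ) {N : ℕ}
    (hN : N ≠ 0) :
    adelicMeasure β ((fun x => posNat q q.2.ne_zero • x) ⁻¹' adeleBall (diag r) N)
      = ENNReal.ofReal ((q : ℝ) ^ β) * adelicMeasure β (adeleBall (diag r) N) := by
  classical
  obtain ⟨T, hT⟩ := exists_finset_closedBall r hN
  set E : ∀ p : PrimeIndex, Set ℚ_[(p : ℕ)] := fun p =>
    Metric.closedBall (diag r p) ‖((N : ℚ) : ℚ_[(p : ℕ)])‖ with hEdef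
  have hE : ∀ p, MeasurableSet (E p) := fun p => Metric.isClosed_closedBall.measurableSet
  have hne : ∀ p : PrimeIndex, p ≠ q → ‖(((q : ℕ) : ℚ) : ℚ_[(p : ℕ)])‖ = 1 := by
    intro p hp
    rw [Rat.cast_natCast]
    exact norm_prime_of_ne q.2 fun h => hp (Subtype.ext h)
  have hpre : (fun x => posNat q q.2.ne_zero • x) ⁻¹' adeleBall (diag r) N
      = box fun p => (fun a => (((q : ℕ) : ℚ) : ℚ_[(p : ℕ)]) * a) ⁻¹' E p := by
    rw [adeleBall_eq_box]; rfl
  have hE' : ∀ p : PrimeIndex,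
      MeasurableSet ((fun a => (((q : ℕ) : ℚ) : ℚ_[(p : ℕ)]) * a) ⁻¹' E p) := fun p =>
    (measurable_const_mul _) (hE p)
  have hqT : q ∈ insert q T := Finset.mem_insert_self _ _
  rw [hpre, adelicMeasure_box hβ hE' (insert q T), adeleBall_eq_box,
    adelicMeasure_box hβ hE (insert q T), ← Finset.mul_prod_erase _ _ hqT,
    ← Finset.mul_prod_erase _ _ hqT, ← mul_assoc]
  · congr 1
    · rw [Rat.cast_natCast]
      exact localMeasure_preimage_prime_mul β (hE q)
    · refine Finset.prod_congr rfl fun p hp => ?_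
      exact localMeasure_preimage_unit_mul β (hne p (Finset.ne_of_mem_erase hp)) (hE p)
  · intro p hp
    exact hT p fun h => hp (Finset.mem_insert_of_mem h)
  · intro p hp
    have h1 : E p = _ := hT p fun h => hp (Finset.mem_insert_of_mem h)
    rw [h1, coe_integers]
    ext x
    simp only [Set.mem_preimage, Metric.mem_closedBall, dist_zero_right, norm_mul,
      hne p (fun h => hp (h ▸ hqT)), one_mul]

/-- Multiplication by a prime `q` scales `μ_β` by `q ^ β`: it scales `μ_{β,q}` by `q ^ β` and
preserves `μ_{β,p}` for `p ≠ q`. -/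
theorem map_prime_smul {β : ℝ} (hβ : 0 < β) (q : PrimeIndex) :
    (adelicMeasure β).map (fun x => posNat q q.2.ne_zero • x)
      = ENNReal.ofReal ((q : ℝ) ^ β) • adelicMeasure β := by
  symm
  refine ext_of_rationalBalls (fun r N hN => ?_) fun r k => ?_
  · exact ENNReal.mul_lt_top ENNReal.ofReal_lt_top (adelicMeasure_ball_lt_top hβ r hN)
  · rw [Measure.map_apply (measurable_smul _) (measurableSet_adeleBall _ _)]
    exact (adelicMeasure_preimage_prime_ball hβ q r (Nat.factorial_ne_zero k)).symm

theorem preimage_smul_nat {β : ℝ} (hβ : 0 < β) {n : ℕ} (hn : n ≠ 0) {E : Set Adeles}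
    (hE : MeasurableSet E) :
    adelicMeasure β ((fun x => posNat n hn • x) ⁻¹' E)
      = ENNReal.ofReal ((n : ℝ) ^ β) * adelicMeasure β E := by
  induction n using Nat.recOnMul generalizing E with
  | zero => exact absurd rfl hn
  | one =>
    have : posNat 1 hn = 1 := Subtype.ext Nat.cast_one
    simp [this]
  | prime l hl =>
    have h := congrArg (fun m => m E) (map_prime_smul hβ ⟨l, hl⟩)
    simp only [Measure.map_apply (measurable_smul _) hE] at h
    exact h
  | mul a b iha ihb =>
    have h : posNat (a * b) hn
        = posNat a (left_ne_zero_of_mul hn) * posNat b (right_ne_zero_of_mul hn) :=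
      Subtype.ext (Nat.cast_mul a b)
    have h' : (fun x : Adeles => posNat (a * b) hn • x) ⁻¹' E
        = (fun x => posNat b (right_ne_zero_of_mul hn) • x) ⁻¹'
          ((fun x => posNat a (left_ne_zero_of_mul hn) • x) ⁻¹' E) := by
      ext x
      simp only [Set.mem_preimage, h, mul_smul]
    rw [h', ihb _ (measurable_smul _ hE), iha _ hE, ← mul_assoc,
      ← ENNReal.ofReal_mul (by positivity), Nat.cast_mul, mul_comm (a : ℝ),
      Real.mul_rpow (by positivity) (by positivity)]

/-- Multiplication by a positive rational `g` is non-singular for `μ_β`. -/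
theorem preimage_smul_null {β : ℝ} (hβ : 0 < β) (g : PosRat) {E : Set Adeles}
    (hE : MeasurableSet E) (h : adelicMeasure β E = 0) :
    adelicMeasure β ((fun x => g • x) ⁻¹' E) = 0 := by
  -- Write `g = n / d`, and let `F` be the preimage of `E` under multiplication by `1 / d`. Then `E`
  -- is the preimage of `F` under `d`, and the preimage of `E` under `g` is that of `F` under `n`.
  have hnum : (g : ℚ).num.toNat ≠ 0 := by
    have := Rat.num_pos.2 g.2
    omega
  have hg : posNat (g : ℚ).den (g : ℚ).den_nz * g = posNat (g : ℚ).num.toNat hnum := by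
    apply Subtype.ext
    change ((g : ℚ).den : ℚ) * (g : ℚ) = (((g : ℚ).num.toNat : ℕ) : ℚ)
    have h1 : (((g : ℚ).num.toNat : ℕ) : ℤ) = (g : ℚ).num :=
      Int.toNat_of_nonneg (Rat.num_pos.2 g.2).le
    rw [Rat.den_mul_eq_num, ← Int.cast_natCast, h1]
  set a := posNat (g : ℚ).den (g : ℚ).den_nz
  set F := (fun x : Adeles => a⁻¹ • x) ⁻¹' E
  have hF : MeasurableSet F := measurable_smul _ hE
  have h1 : (fun x : Adeles => a • x) ⁻¹' F = E := by
    ext x; simp [F]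
  have h2 := preimage_smul_nat hβ (g : ℚ).den_nz hF
  rw [show (fun x : Adeles => posNat (g : ℚ).den (g : ℚ).den_nz • x) ⁻¹' F = E from h1, h] at h2
  have h3 : adelicMeasure β F = 0 := by
    refine (mul_eq_zero.1 h2.symm).resolve_left ?_
    rw [ENNReal.ofReal_eq_zero, not_le]
    have : 0 < (g : ℚ).den := (g : ℚ).den_pos
    positivity
  have h4 : (fun x : Adeles => g • x) ⁻¹' E
      = (fun x => posNat (g : ℚ).num.toNat hnum • x) ⁻¹' F := by
    ext x
    simp only [Set.mem_preimage, F, ← hg, mul_smul, inv_smul_smul]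
  rw [h4, preimage_smul_nat hβ hnum hF, h3, mul_zero]

/-! ### Partial Euler products of a Dirichlet character -/

/-- If `Re w ≥ 0`, then `u ↦ ‖1 + u w‖` is non-decreasing on `[0, ∞)`. -/
theorem norm_one_add_mul_mono {w : ℂ} (hw : 0 ≤ w.re) {u v : ℝ} (hu : 0 ≤ u) (huv : u ≤ v) :
    ‖1 + u * w‖ ≤ ‖1 + v * w‖ := by
  refine le_of_sq_le_sq ?_ (norm_nonneg _)
  have h : ∀ t : ℝ, ‖1 + t * w‖ ^ 2 = 1 + 2 * t * w.re + t ^ 2 * ‖w‖ ^ 2 := by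
    intro t
    rw [← Complex.normSq_eq_norm_sq, ← Complex.normSq_eq_norm_sq, Complex.normSq_apply,
      Complex.normSq_apply]
    simp
    ring
  rw [h, h]
  gcongr

/-- For `‖z‖ ≤ 1`, the function `t ↦ (1 - t) / ‖1 - z t‖` is non-increasing on `[0, 1)`. -/
theorem one_sub_mul_norm_le {z : ℂ} (hz : ‖z‖ ≤ 1) {s t : ℝ} (hs : 0 ≤ s) (hst : s ≤ t)
    (ht : t < 1) : (1 - t) * ‖1 - z * s‖ ≤ (1 - s) * ‖1 - z * t‖ := by
  have h1 : 0 < 1 - t := by linarith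
  have h2 : 0 < 1 - s := by linarith
  have key : ∀ r : ℝ, 0 < 1 - r →
      ‖1 - z * r‖ = (1 - r) * ‖1 + ((r / (1 - r) : ℝ) : ℂ) * (1 - z)‖ := by
    intro r hr
    have hr' : (1 - r : ℂ) ≠ 0 := by exact_mod_cast hr.ne'
    have : 1 - z * r = ((1 - r : ℝ) : ℂ) * (1 + ((r / (1 - r) : ℝ) : ℂ) * (1 - z)) := by
      push_cast
      field_simp
      ring
    rw [this, norm_mul, Complex.norm_real, Real.norm_of_nonneg hr.le]
  rw [key s h2, key t h1, mul_left_comm]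
  refine mul_le_mul_of_nonneg_left (mul_le_mul_of_nonneg_left
    (norm_one_add_mul_mono ?_ (by positivity) ?_) h1.le) h2.le
  · have := (Complex.re_le_norm z).trans hz
    simpa using this
  · rw [div_le_div_iff₀ h2 h1]
    nlinarith

/-- For a non-trivial Dirichlet character `χ` and `0 < β ≤ 1`, the partial Euler products of
`L(χ, β) / ζ(β)` come arbitrarily close to `0`. Otherwise, by monotonicity in the exponent,
`L(χ, s) / ζ(s)` would be bounded away from `0` for `s > 1`; but `ζ` has a pole at `1` and
`L(χ, ·)` has none. -/
theorem exists_eulerFactor_prod_lt {N : ℕ} [NeZero N] {χ : DirichletCharacter ℂ N} (hχ : χ ≠ 1)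
    {β : ℝ} (hβ₀ : 0 < β) (hβ₁ : β ≤ 1) {ε : ℝ} (hε : 0 < ε) :
    ∃ A : Finset PrimeIndex, ∏ p ∈ A, (1 - (p : ℝ) ^ (-β))
      < ε * ∏ p ∈ A, ‖1 - χ (p : ℕ) * (((p : ℝ) ^ (-β) : ℝ) : ℂ)‖ := by
  by_contra! hcon
  have hlt : ∀ (p : PrimeIndex) {s : ℝ}, 0 < s → (p : ℝ) ^ (-s) < 1 := fun p s hs =>
    Real.rpow_lt_one_of_one_lt_of_neg (by exact_mod_cast p.2.one_lt) (by linarith)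
  have hnn : ∀ (p : PrimeIndex) (s : ℝ), 0 ≤ (p : ℝ) ^ (-s) := fun p s => by positivity
  have hne : ∀ (p : PrimeIndex) {s : ℝ}, 0 < s →
      0 < ‖1 - χ (p : ℕ) * (((p : ℝ) ^ (-s) : ℝ) : ℂ)‖ := by
    intro p s hs
    rw [norm_pos_iff, sub_ne_zero]
    intro h
    have h1 := congrArg norm h
    rw [norm_one, norm_mul, Complex.norm_real, Real.norm_of_nonneg (hnn p s)] at h1
    have h2 := mul_le_mul (χ.norm_le_one (p : ℕ)) le_rfl (hnn p s) zero_le_one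
    have h3 := hlt p hs
    linarith
  -- The assumed lower bound at the exponent `β` passes to all exponents `s > 1`.
  have step : ∀ s : ℝ, 1 < s → ∀ A : Finset PrimeIndex,
      ε * ‖∏ p ∈ A, (1 - ((p : ℕ) : ℂ) ^ (-(s : ℂ)))⁻¹‖
        ≤ ‖∏ p ∈ A, (1 - χ (p : ℕ) * ((p : ℕ) : ℂ) ^ (-(s : ℂ)))⁻¹‖ := by
    intro s hs A
    have hs0 : 0 < s := one_pos.trans hs
    have hcast : ∀ p : PrimeIndex, ((p : ℕ) : ℂ) ^ (-(s : ℂ)) = (((p : ℝ) ^ (-s) : ℝ) : ℂ) := by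
      intro p
      rw [Complex.ofReal_cpow (by positivity)]
      push_cast
      rfl
    have h1 : (∏ p ∈ A, (1 - (p : ℝ) ^ (-β))) *
          ∏ p ∈ A, ‖1 - χ (p : ℕ) * (((p : ℝ) ^ (-s) : ℝ) : ℂ)‖
        ≤ (∏ p ∈ A, (1 - (p : ℝ) ^ (-s))) *
          ∏ p ∈ A, ‖1 - χ (p : ℕ) * (((p : ℝ) ^ (-β) : ℝ) : ℂ)‖ := by
      rw [← Finset.prod_mul_distrib, ← Finset.prod_mul_distrib]
      refine Finset.prod_le_prod (fun p _ => mul_nonneg (sub_nonneg.2 (hlt p hβ₀).le)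
        (norm_nonneg _)) fun p _ => one_sub_mul_norm_le (χ.norm_le_one _) (hnn p s) ?_ (hlt p hβ₀)
      exact Real.rpow_le_rpow_of_exponent_le (by exact_mod_cast p.2.one_lt.le) (by linarith)
    have hb : 0 < ∏ p ∈ A, (1 - (p : ℝ) ^ (-β)) :=
      Finset.prod_pos fun p _ => sub_pos.2 (hlt p hβ₀)
    have hb' : 0 < ∏ p ∈ A, (1 - (p : ℝ) ^ (-s)) :=
      Finset.prod_pos fun p _ => sub_pos.2 (hlt p hs0)
    have hc' : 0 < ∏ p ∈ A, ‖1 - χ (p : ℕ) * (((p : ℝ) ^ (-s) : ℝ) : ℂ)‖ :=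
      Finset.prod_pos fun p _ => hne p hs0
    have h2 : ε * ∏ p ∈ A, ‖1 - χ (p : ℕ) * (((p : ℝ) ^ (-s) : ℝ) : ℂ)‖
        ≤ ∏ p ∈ A, (1 - (p : ℝ) ^ (-s)) := by
      refine le_of_mul_le_mul_left ?_ hb
      have h3 := mul_le_mul_of_nonneg_left h1 hε.le
      have h4 := mul_le_mul_of_nonneg_left (hcon A) hb'.le
      nlinarith
    simp only [hcast, norm_prod, norm_inv, Finset.prod_inv_distrib]
    have h5 : ∀ p : PrimeIndex, ‖(1 : ℂ) - (((p : ℝ) ^ (-s) : ℝ) : ℂ)‖ = 1 - (p : ℝ) ^ (-s) := by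
      intro p
      rw [← Complex.ofReal_one, ← Complex.ofReal_sub, Complex.norm_real,
        Real.norm_of_nonneg (sub_nonneg.2 (hlt p hs0).le)]
    simp only [h5]
    rw [← div_eq_mul_inv, div_le_iff₀ hb', inv_mul_eq_div, le_div_iff₀ hc']
    exact h2
  have hlim : ∀ s : ℝ, 1 < s → ε * ‖riemannZeta s‖ ≤ ‖DirichletCharacter.LFunction χ s‖ := by
    intro s hs
    have hs' : 1 < (s : ℂ).re := by simpa using hs
    have hz := riemannZeta_eulerProduct_hasProd hs'
    have hL := DirichletCharacter.LSeries_eulerProduct_hasProd χ hs'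
    rw [DirichletCharacter.LFunction_eq_LSeries χ hs']
    exact le_of_tendsto_of_tendsto' (hz.norm.const_mul ε) hL.norm fun (A : Finset PrimeIndex) =>
      (congrArg₂ (fun a b : ℝ => ε * a ≤ b) (norm_prod A _) (norm_prod A _)).mp (step s hs A)
  -- Multiply by `s - 1` and let `s` tend to `1` from above.
  have hcoe : Filter.Tendsto (fun s : ℝ => (s : ℂ)) (nhdsWithin 1 (Set.Ioi 1)) (nhds 1) :=
    (Complex.continuous_ofReal.tendsto' 1 1 Complex.ofReal_one).mono_left nhdsWithin_le_nhds
  have hcoe' : Filter.Tendsto (fun s : ℝ => (s : ℂ)) (nhdsWithin 1 (Set.Ioi 1))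
      (nhdsWithin 1 {1}ᶜ) := by
    refine tendsto_nhdsWithin_iff.2 ⟨hcoe, ?_⟩
    filter_upwards [self_mem_nhdsWithin] with s hs
    have : s ≠ 1 := (Set.mem_Ioi.1 hs).ne'
    simpa using this
  have h1 := ((riemannZeta_residue_one.comp hcoe').norm).const_mul ε
  have h2 : Filter.Tendsto (fun s : ℝ => ‖((s : ℂ) - 1) * DirichletCharacter.LFunction χ s‖)
      (nhdsWithin 1 (Set.Ioi 1)) (nhds ‖((1 : ℂ) - 1) * DirichletCharacter.LFunction χ 1‖) :=
    (((hcoe.sub_const 1)).mul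
      (((DirichletCharacter.differentiable_LFunction hχ).continuous.tendsto 1).comp hcoe)).norm
  have h3 := le_of_tendsto_of_tendsto h1 h2 (by
    filter_upwards [self_mem_nhdsWithin] with s hs
    simp only [Function.comp, norm_mul]
    have := mul_le_mul_of_nonneg_left (hlim s hs) (norm_nonneg ((s : ℂ) - 1))
    linarith)
  simp at h3
  linarith

/-! ### Sieving invariant functions by primes -/

/-- The adeles that are integral at all primes and units at the primes of `A`. -/
def integralAdeles (A : Finset PrimeIndex) : Set Adeles :=
  {x | (∀ p : PrimeIndex, ‖x p‖ ≤ 1) ∧ ∀ p ∈ A, ‖x p‖ = 1}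

theorem integralAdeles_eq_box (A : Finset PrimeIndex) [DecidablePred (· ∈ A)] :
    integralAdeles A = box fun p =>
      if p ∈ A then unitSphere (p : ℕ) else PadicInt.subring (p : ℕ) := by
  ext x
  simp only [integralAdeles, box, Set.mem_ofPred_eq]
  constructor
  · rintro ⟨h1, h2⟩ p
    split_ifs with hp
    · exact h2 p hp
    · exact h1 p
  · intro h
    refine ⟨fun p => ?_, fun p hp => ?_⟩
    · have := h p
      split_ifs at this with hp
      · exact le_of_eq this
      · exact this
    · have := h p
      rwa [if_pos hp] at this

theorem measurableSet_integralAdeles (A : Finset PrimeIndex) :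
    MeasurableSet (integralAdeles A) := by
  classical
  rw [integralAdeles_eq_box]
  refine measurableSet_box fun p => ?_
  split_ifs
  · exact measurableSet_unitSphere
  · exact (isOpen_integers p).measurableSet

theorem adelicMeasure_integralAdeles {β : ℝ} (hβ : 0 < β) (A : Finset PrimeIndex) :
    adelicMeasure β (integralAdeles A) = ENNReal.ofReal (∏ p ∈ A, (1 - (p : ℝ) ^ (-β))) := by
  classical
  rw [integralAdeles_eq_box, adelicMeasure_box hβ (fun p => ?_) A (fun p hp => if_neg hp),
    ENNReal.ofReal_prod_of_nonneg fun p _ => (sub_pos.2 (rpow_neg_lt_one hβ)).le]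
  · refine Finset.prod_congr rfl fun p hp => ?_
    rw [if_pos hp, localMeasure_unitSphere β hβ]
  · split_ifs
    · exact measurableSet_unitSphere
    · exact (isOpen_integers p).measurableSet

theorem integralAdeles_insert [DecidableEq PrimeIndex] (q : PrimeIndex) (A : Finset PrimeIndex) :
    integralAdeles (insert q A) = integralAdeles A \ {x | ‖x q‖ < 1} := by
  ext x
  simp only [integralAdeles, Set.mem_ofPred_eq, Set.mem_sdiff, Finset.mem_insert, forall_eq_or_imp,
    not_lt]
  constructor
  · rintro ⟨h1, h2, h3⟩
    exact ⟨⟨h1, h3⟩, h2.ge⟩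
  · rintro ⟨⟨h1, h3⟩, h2⟩
    exact ⟨h1, (h1 q).antisymm h2, h3⟩

/-- For `q ∉ A`, the adeles of `integralAdeles A` that are not units at `q` are the products `q x`
with `x` in `integralAdeles A`. -/
theorem prime_smul_mem_iff {q : PrimeIndex} {A : Finset PrimeIndex} (hq : q ∉ A) (x : Adeles) :
    posNat q q.2.ne_zero • x ∈ integralAdeles A ∩ {x | ‖x q‖ < 1} ↔ x ∈ integralAdeles A := by
  have hne : ∀ p : PrimeIndex, p ≠ q → ‖(posNat q q.2.ne_zero • x) p‖ = ‖x p‖ := by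
    intro p hp
    rw [posNat_smul_apply, norm_mul, norm_prime_of_ne q.2 fun h => hp (Subtype.ext h), one_mul]
  have hq' : (0 : ℝ) < q := by exact_mod_cast q.2.pos
  have hq1 : (q : ℝ)⁻¹ < 1 := inv_lt_one_of_one_lt₀ (by exact_mod_cast q.2.one_lt)
  have heq : ‖(posNat q q.2.ne_zero • x) q‖ = (q : ℝ)⁻¹ * ‖x q‖ := by
    rw [posNat_smul_apply, norm_mul, Padic.norm_p]
  simp only [integralAdeles, Set.mem_inter_iff, Set.mem_ofPred_eq]
  constructor
  · rintro ⟨⟨h1, h2⟩, h3⟩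
    refine ⟨fun p => ?_, fun p hp => ?_⟩
    · by_cases hp : p = q
      · subst hp
        have h4 := padic_norm_le_inv_of_lt_one h3
        rw [heq] at h4
        exact le_of_mul_le_mul_left (by simpa using h4) (inv_pos.2 hq')
      · rw [← hne p hp]; exact h1 p
    · rw [← hne p (fun h => hq (h ▸ hp))]; exact h2 p hp
  · rintro ⟨h1, h2⟩
    have h3 : ‖(posNat q q.2.ne_zero • x) q‖ < 1 := by
      rw [heq]
      exact (mul_le_of_le_one_right (inv_pos.2 hq').le (h1 q)).trans_lt hq1
    refine ⟨⟨fun p => ?_, fun p hp => ?_⟩, h3⟩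
    · by_cases hp : p = q
      · subst hp; exact h3.le
      · rw [hne p hp]; exact h1 p
    · rw [hne p (fun h => hq (h ▸ hp))]; exact h2 p hp

/-- Sieving one prime `q`: by the scaling property of `μ_β`, the part of the integral over multiples
of `q` is `c q^{-β}` times the whole integral, if `h (q x) = c h x`. -/
theorem setIntegral_insert {β : ℝ} (hβ : 0 < β) {X : Set Adeles} (hXm : MeasurableSet X)
    (hX : ∀ g : PosRat, (fun x : Adeles => g • x) ⁻¹' X =ᵐ[adelicMeasure β] X)
    {h : Adeles → ℂ} (hm : Measurable h) (hb : ∀ x, ‖h x‖ ≤ 1) {q : PrimeIndex} {c : ℂ}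
    (hc : ∀ x ∈ integralAdeles ∅, h (posNat q q.2.ne_zero • x) = c * h x)
    [DecidableEq PrimeIndex] {A : Finset PrimeIndex} (hq : q ∉ A) :
    ∫ x in X ∩ integralAdeles (insert q A), h x ∂adelicMeasure β
      = (1 - c * (((q : ℝ) ^ (-β) : ℝ) : ℂ))
        * ∫ x in X ∩ integralAdeles A, h x ∂adelicMeasure β := by
  set μ := adelicMeasure β with hμ
  set B : Set Adeles := {x | ‖x q‖ < 1} with hBdef
  have hB : MeasurableSet B :=
    (isOpen_lt (continuous_norm.comp (RestrictedProduct.continuous_eval q))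
      continuous_const).measurableSet
  have hA := measurableSet_integralAdeles A
  have hfin : μ (X ∩ integralAdeles A) < ∞ := by
    refine (measure_mono Set.inter_subset_right).trans_lt ?_
    rw [hμ, adelicMeasure_integralAdeles hβ]
    exact ENNReal.ofReal_lt_top
  have hint : IntegrableOn h (X ∩ integralAdeles A) μ :=
    Measure.integrableOn_of_bounded hfin.ne hm.aestronglyMeasurable (M := 1)
      (Filter.Eventually.of_forall hb)
  have hset : X ∩ integralAdeles (insert q A)
      = (X ∩ integralAdeles A) \ (X ∩ (integralAdeles A ∩ B)) := by
    rw [integralAdeles_insert]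
    ext x
    simp only [Set.mem_inter_iff, Set.mem_sdiff, hBdef]
    tauto
  have hG : MeasurableSet (X ∩ (integralAdeles A ∩ B)) := hXm.inter (hA.inter hB)
  rw [hset, setIntegral_sdiff hG hint (Set.inter_subset_inter_right _ Set.inter_subset_left)]
  have hq' : (0 : ℝ) < q := by exact_mod_cast q.2.pos
  -- Substitute `q x` for `x` in the integral over the multiples of `q`.
  have hmap := map_prime_smul hβ q
  have h1 : ∫ x, (X ∩ (integralAdeles A ∩ B)).indicator h x
        ∂(μ.map (fun x => posNat q q.2.ne_zero • x))
      = ∫ x, (X ∩ (integralAdeles A ∩ B)).indicator h (posNat q q.2.ne_zero • x) ∂μ :=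
    integral_map (measurable_smul _).aemeasurable (hm.indicator hG).aestronglyMeasurable
  have h2 : ∫ x, (X ∩ (integralAdeles A ∩ B)).indicator h (posNat q q.2.ne_zero • x) ∂μ
      = ∫ x, (X ∩ integralAdeles A).indicator (fun x => c * h x) x ∂μ := by
    refine integral_congr_ae ?_
    filter_upwards [hX (posNat q q.2.ne_zero)] with x hx
    have hx' : posNat q q.2.ne_zero • x ∈ X ↔ x ∈ X := iff_of_eq hx
    have hiff : posNat q q.2.ne_zero • x ∈ X ∩ (integralAdeles A ∩ B) ↔ x ∈ X ∩ integralAdeles A :=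
      and_congr hx' (prime_smul_mem_iff hq x)
    by_cases hxA : x ∈ X ∩ integralAdeles A
    · rw [Set.indicator_of_mem (hiff.2 hxA), Set.indicator_of_mem hxA]
      exact hc x ⟨hxA.2.1, by simp⟩
    · rw [Set.indicator_of_notMem (fun h => hxA (hiff.1 h)), Set.indicator_of_notMem hxA]
  rw [hmap, h2, integral_smul_measure, integral_indicator hG, integral_indicator (hXm.inter hA),
    integral_const_mul, ENNReal.toReal_ofReal (by positivity), Complex.real_smul] at h1
  have h3 : (((q : ℝ) ^ (-β) : ℝ) : ℂ) * (((q : ℝ) ^ β : ℝ) : ℂ) = 1 := by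
    rw [← Complex.ofReal_mul, ← Real.rpow_add hq']
    simp
  have h4 := congrArg (fun z => (((q : ℝ) ^ (-β) : ℝ) : ℂ) * z) h1
  simp only [← mul_assoc, h3, one_mul] at h4
  rw [h4]
  ring

/-- Removing from the integral adeles the multiples of the primes of `A` multiplies the integral of
an invariant function against `h` by a partial Euler product. -/
theorem setIntegral_integralAdeles {β : ℝ} (hβ : 0 < β) {X : Set Adeles} (hXm : MeasurableSet X)
    (hX : ∀ g : PosRat, (fun x : Adeles => g • x) ⁻¹' X =ᵐ[adelicMeasure β] X)
    {h : Adeles → ℂ} (hm : Measurable h) (hb : ∀ x, ‖h x‖ ≤ 1) {c : PrimeIndex → ℂ}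
    (hc : ∀ q : PrimeIndex, ∀ x ∈ integralAdeles ∅, h (posNat q q.2.ne_zero • x) = c q * h x)
    (A : Finset PrimeIndex) :
    ∫ x in X ∩ integralAdeles A, h x ∂adelicMeasure β
      = (∏ q ∈ A, (1 - c q * (((q : ℝ) ^ (-β) : ℝ) : ℂ)))
        * ∫ x in X ∩ integralAdeles ∅, h x ∂adelicMeasure β := by
  classical
  induction A using Finset.induction_on with
  | empty => simp
  | insert q A hq ih =>
    rw [setIntegral_insert hβ hXm hX hm hb (hc q) hq, ih, Finset.prod_insert hq, mul_assoc]

/-! ### Residue classes and Dirichlet characters -/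

theorem dvd_of_forall_norm_le {N : ℕ} {k : ℤ}
    (h : ∀ p : PrimeIndex, ‖(k : ℚ_[(p : ℕ)])‖ ≤ ‖(N : ℚ_[(p : ℕ)])‖) : (N : ℤ) ∣ k := by
  rw [← Int.dvd_natAbs, Int.natCast_dvd_natCast, Nat.dvd_iff_prime_pow_dvd_dvd]
  intro p j hp hj
  have : Fact p.Prime := ⟨hp⟩
  have h1 : ‖((N : ℤ) : ℚ_[p])‖ ≤ (p : ℝ) ^ (-j : ℤ) :=
    (Padic.norm_int_le_pow_iff_dvd _ _).2 (by exact_mod_cast hj)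
  have h2 : ‖(k : ℚ_[p])‖ ≤ (p : ℝ) ^ (-j : ℤ) := (h ⟨p, hp⟩).trans (by simpa using h1)
  rw [Padic.norm_int_le_pow_iff_dvd] at h2
  rw [← Int.natCast_dvd_natCast, Int.dvd_natAbs]
  exact_mod_cast h2

/-- The integral adeles congruent to `a` modulo `N`. -/
def residueClass (N a : ℕ) : Set Adeles := adeleBall (diag (a : ℚ)) (N : ℚ)

theorem mem_residueClass {N a : ℕ} {x : Adeles} :
    x ∈ residueClass N a ↔ ∀ p : PrimeIndex, ‖x p - (a : ℚ_[(p : ℕ)])‖ ≤ ‖(N : ℚ_[(p : ℕ)])‖ := by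
  simp only [residueClass, mem_adeleBall_diag, Rat.cast_natCast]

theorem natCast_zmod_eq_of_mem {N a b : ℕ} {x : Adeles} (ha : x ∈ residueClass N a)
    (hb : x ∈ residueClass N b) : (a : ZMod N) = b := by
  rw [mem_residueClass] at ha hb
  have : (N : ℤ) ∣ (b : ℤ) - a := by
    refine dvd_of_forall_norm_le fun p => ?_
    have := padic_norm_sub_le (x p - (a : ℚ_[(p : ℕ)])) (x p - (b : ℚ_[(p : ℕ)]))
    rw [sub_sub_sub_cancel_left] at this
    push_cast
    exact this.trans (max_le (ha p) (hb p))
  have h := (ZMod.intCast_eq_intCast_iff_dvd_sub (a : ℤ) b N).2 this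
  simpa using h

theorem residueClass_congr {N a b : ℕ} (h : (a : ZMod N) = b) :
    residueClass N a = residueClass N b := by
  have h1 : (N : ℤ) ∣ (b : ℤ) - a := by
    rw [← ZMod.intCast_eq_intCast_iff_dvd_sub]; simpa using h
  refine (adeleBall_eq_of_mem fun p => ?_)
  obtain ⟨k, hk⟩ := h1
  rw [norm_sub_rev, diag_apply, diag_apply]
  have h2 : (((b : ℚ) : ℚ_[(p : ℕ)])) - ((a : ℚ) : ℚ_[(p : ℕ)]) = (N : ℚ_[(p : ℕ)]) * (k : ℤ) := by
    push_cast
    exact_mod_cast hk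
  rw [h2, norm_mul, Rat.cast_natCast]
  exact mul_le_of_le_one_right (norm_nonneg _) (Padic.norm_int_le_one _)

theorem residueClass_subset (N a : ℕ) : residueClass N a ⊆ integralAdeles ∅ := by
  intro x hx
  rw [mem_residueClass] at hx
  refine ⟨fun p => ?_, by simp⟩
  have := Padic.nonarchimedean (x p - (a : ℚ_[(p : ℕ)])) (a : ℚ_[(p : ℕ)])
  rw [sub_add_cancel] at this
  exact this.trans
    (max_le ((hx p).trans (padic_norm_natCast_le_one N)) (padic_norm_natCast_le_one a))

theorem exists_mem_residueClass {N : ℕ} (hN : N ≠ 0) {x : Adeles} (hx : x ∈ integralAdeles ∅) :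
    ∃ a : ℕ, x ∈ residueClass N a := by
  obtain ⟨a, ha⟩ := exists_nat_near hN hx.1
  exact ⟨a, mem_residueClass.2 ha⟩

/-- The function `x ↦ χ (x mod N)` on the integral adeles, extended by `0`. -/
def charFn {N : ℕ} [NeZero N] (χ : DirichletCharacter ℂ N) (x : Adeles) : ℂ :=
  ∑ a : ZMod N, (residueClass N a.val).indicator (fun _ => χ a) x

theorem charFn_of_mem {N : ℕ} [NeZero N] (χ : DirichletCharacter ℂ N) {a : ℕ} {x : Adeles}
    (hx : x ∈ residueClass N a) : charFn χ x = χ a := by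
  classical
  have hval : residueClass N (a : ZMod N).val = residueClass N a :=
    residueClass_congr (ZMod.natCast_zmod_val _)
  rw [charFn, Finset.sum_eq_single (a : ZMod N)]
  · rw [hval, Set.indicator_of_mem hx]
  · intro b _ hb
    refine Set.indicator_of_notMem (fun h => hb ?_) _
    have := natCast_zmod_eq_of_mem h hx
    rwa [ZMod.natCast_zmod_val] at this
  · intro h; exact absurd (Finset.mem_univ _) h

theorem charFn_of_notMem {N : ℕ} [NeZero N] (χ : DirichletCharacter ℂ N) {x : Adeles}
    (hx : x ∉ integralAdeles ∅) : charFn χ x = 0 :=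
  Finset.sum_eq_zero fun _ _ => Set.indicator_of_notMem (fun h => hx (residueClass_subset _ _ h)) _

theorem measurable_charFn {N : ℕ} [NeZero N] (χ : DirichletCharacter ℂ N) :
    Measurable (charFn χ) :=
  Finset.measurable_fun_sum _ fun _ _ => measurable_const.indicator (measurableSet_adeleBall _ _)

theorem norm_charFn_le_one {N : ℕ} [NeZero N] (χ : DirichletCharacter ℂ N) (x : Adeles) :
    ‖charFn χ x‖ ≤ 1 := by
  by_cases hx : x ∈ integralAdeles ∅
  · obtain ⟨a, ha⟩ := exists_mem_residueClass (NeZero.ne N) hx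
    rw [charFn_of_mem χ ha]
    exact χ.norm_le_one _
  · rw [charFn_of_notMem χ hx]
    simp

theorem posNat_smul_mem_residueClass {n : ℕ} (hn : n ≠ 0) {N a : ℕ} {x : Adeles} :
    posNat n hn • x ∈ residueClass (n * N) (n * a) ↔ x ∈ residueClass N a := by
  rw [mem_residueClass, mem_residueClass]
  refine forall_congr' fun p => ?_
  have hnp : (n : ℚ_[(p : ℕ)]) ≠ 0 := by exact_mod_cast hn
  rw [posNat_smul_apply, Nat.cast_mul, Nat.cast_mul, ← mul_sub, norm_mul, norm_mul,
    mul_le_mul_iff_right₀ (norm_pos_iff.2 hnp)]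

theorem charFn_smul {N : ℕ} [NeZero N] (χ : DirichletCharacter ℂ N) (q : PrimeIndex) {x : Adeles}
    (hx : x ∈ integralAdeles ∅) :
    charFn χ (posNat q q.2.ne_zero • x) = χ (q : ℕ) * charFn χ x := by
  obtain ⟨a, ha⟩ := exists_mem_residueClass (NeZero.ne N) hx
  have h1 : posNat q q.2.ne_zero • x ∈ residueClass N (q * a) := by
    have := (posNat_smul_mem_residueClass q.2.ne_zero).2 ha
    rw [mem_residueClass] at this ⊢
    exact fun p => (this p).trans (norm_cast_le_of_dvd (Dvd.intro_left _ rfl) _)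
  rw [charFn_of_mem χ ha, charFn_of_mem χ h1, Nat.cast_mul, map_mul]

section Invariant

variable {β : ℝ} {X : Set Adeles}

/-- The integrals of an invariant indicator function against a non-trivial character vanish: the
sieve produces the partial Euler products of `ζ(β) / L(χ, β)`. -/
theorem setIntegral_charFn_eq_zero (hβ₀ : 0 < β) (hβ₁ : β ≤ 1) (hXm : MeasurableSet X)
    (hX : ∀ g : PosRat, (fun x : Adeles => g • x) ⁻¹' X =ᵐ[adelicMeasure β] X)
    {N : ℕ} [NeZero N] {χ : DirichletCharacter ℂ N} (hχ : χ ≠ 1) :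
    ∫ x in X ∩ integralAdeles ∅, charFn χ x ∂adelicMeasure β = 0 := by
  by_contra hne
  obtain ⟨A, hA⟩ := exists_eulerFactor_prod_lt hχ hβ₀ hβ₁ (norm_pos_iff.2 hne)
  have h1 := setIntegral_integralAdeles hβ₀ hXm hX (measurable_charFn χ) (norm_charFn_le_one χ)
    (c := fun q => χ (q : ℕ)) (fun q x hx => charFn_smul χ q hx) A
  have hle : adelicMeasure β (X ∩ integralAdeles A)
      ≤ ENNReal.ofReal (∏ p ∈ A, (1 - (p : ℝ) ^ (-β))) :=
    (measure_mono Set.inter_subset_right).trans (adelicMeasure_integralAdeles hβ₀ A).le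
  have h2 : ‖∫ x in X ∩ integralAdeles A, charFn χ x ∂adelicMeasure β‖
      ≤ 1 * (adelicMeasure β).real (X ∩ integralAdeles A) :=
    norm_setIntegral_le_of_norm_le_const (hle.trans_lt ENNReal.ofReal_lt_top)
      fun x _ => norm_charFn_le_one χ x
  have h3 : (adelicMeasure β).real (X ∩ integralAdeles A) ≤ ∏ p ∈ A, (1 - (p : ℝ) ^ (-β)) :=
    ENNReal.toReal_le_of_le_ofReal
      (Finset.prod_nonneg fun p _ => (sub_pos.2 (rpow_neg_lt_one hβ₀)).le) hle
  rw [h1, norm_mul, norm_prod] at h2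
  linarith

/-- The primes dividing `N`. -/
def primesDividing (N : ℕ) : Finset PrimeIndex := N.primeFactors.subtype Nat.Prime

theorem mem_primesDividing {N : ℕ} (hN : N ≠ 0) {p : PrimeIndex} :
    p ∈ primesDividing N ↔ (p : ℕ) ∣ N := by
  simp [primesDividing, hN, p.2]

/-- An integral adele is a unit at all primes dividing `N` iff its class modulo `N` is a unit. -/
theorem mem_integralAdeles_primesDividing {N : ℕ} (hN : N ≠ 0) {a : ℕ} {x : Adeles}
    (hx : x ∈ residueClass N a) : x ∈ integralAdeles (primesDividing N) ↔ a.Coprime N := by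
  have hW := residueClass_subset _ _ hx
  rw [mem_residueClass] at hx
  have hlt : ∀ p : PrimeIndex, (p : ℕ) ∣ N → ‖(N : ℚ_[(p : ℕ)])‖ < 1 := by
    intro p hp
    rwa [Padic.norm_natCast_lt_one_iff]
  constructor
  · intro h
    refine Nat.coprime_of_dvd fun k hk hka hkN => ?_
    obtain ⟨p, rfl⟩ : ∃ p : PrimeIndex, (p : ℕ) = k := ⟨⟨k, hk⟩, rfl⟩
    have h1 := h.2 p ((mem_primesDividing hN).2 hkN)
    have h2 : ‖(a : ℚ_[(p : ℕ)])‖ < 1 := by rwa [Padic.norm_natCast_lt_one_iff]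
    have h3 := Padic.nonarchimedean (x p - (a : ℚ_[(p : ℕ)])) (a : ℚ_[(p : ℕ)])
    rw [sub_add_cancel, h1] at h3
    exact absurd (h3.trans_lt (max_lt ((hx p).trans_lt (hlt p hkN)) h2)) (lt_irrefl _)
  · intro h
    refine ⟨hW.1, fun p hp => (hW.1 p).antisymm ?_⟩
    rw [mem_primesDividing hN] at hp
    by_contra! hlt'
    have h3 := padic_norm_sub_le (x p) (x p - (a : ℚ_[(p : ℕ)]))
    rw [sub_sub_cancel] at h3
    have h4 := h3.trans_lt (max_lt hlt' ((hx p).trans_lt (hlt p hp)))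
    rw [Padic.norm_natCast_lt_one_iff] at h4
    exact Nat.not_coprime_of_dvd_of_dvd p.2.one_lt h4 hp h

theorem charFn_one {N : ℕ} [NeZero N] (x : Adeles) :
    charFn (1 : DirichletCharacter ℂ N) x
      = (integralAdeles (primesDividing N)).indicator (fun _ => 1) x := by
  classical
  by_cases hx : x ∈ integralAdeles ∅
  · obtain ⟨a, ha⟩ := exists_mem_residueClass (NeZero.ne N) hx
    rw [charFn_of_mem _ ha, Set.indicator_apply, mem_integralAdeles_primesDividing (NeZero.ne N) ha,
      ← ZMod.isUnit_iff_coprime]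
    split_ifs with h
    · exact MulChar.one_apply h
    · exact MulChar.map_nonunit _ h
  · rw [charFn_of_notMem _ hx, Set.indicator_of_notMem]
    exact fun h => hx ⟨h.1, by simp⟩

theorem adelicMeasure_inter_lt_top (hβ : 0 < β) (X : Set Adeles) (A : Finset PrimeIndex) :
    adelicMeasure β (X ∩ integralAdeles A) < ∞ :=
  (measure_mono Set.inter_subset_right).trans_lt (by
    rw [adelicMeasure_integralAdeles hβ]; exact ENNReal.ofReal_lt_top)

theorem setIntegral_charFn_one (hβ : 0 < β) (hXm : MeasurableSet X)
    (hX : ∀ g : PosRat, (fun x : Adeles => g • x) ⁻¹' X =ᵐ[adelicMeasure β] X)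
    {N : ℕ} [NeZero N] :
    ∫ x in X ∩ integralAdeles ∅, charFn (1 : DirichletCharacter ℂ N) x ∂adelicMeasure β
      = (∏ q ∈ primesDividing N, (1 - (((q : ℝ) ^ (-β) : ℝ) : ℂ)))
        * ((adelicMeasure β).real (X ∩ integralAdeles ∅) : ℂ) := by
  have h1 := setIntegral_integralAdeles hβ hXm hX (h := fun _ => 1) measurable_const (by simp)
    (c := fun _ => 1) (by simp) (primesDividing N)
  simp only [one_mul] at h1
  simp only [charFn_one]
  rw [setIntegral_indicator (measurableSet_integralAdeles _), Set.inter_assoc,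
    Set.inter_eq_right.2 (show integralAdeles (primesDividing N) ⊆ integralAdeles ∅ from
      fun x hx => ⟨hx.1, by simp⟩), h1]
  simp

/-- Orthogonality of characters expresses the indicator function of an invertible residue class
through the functions `charFn χ`, of which only the one of the trivial character contributes. -/
theorem totient_mul_measure_residueClass (hβ₀ : 0 < β) (hβ₁ : β ≤ 1) (hXm : MeasurableSet X)
    (hX : ∀ g : PosRat, (fun x : Adeles => g • x) ⁻¹' X =ᵐ[adelicMeasure β] X)
    {N a : ℕ} [NeZero N] (ha : a.Coprime N) :
    (N.totient : ℂ) * ((adelicMeasure β).real (X ∩ residueClass N a) : ℂ)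
      = (∏ q ∈ primesDividing N, (1 - (((q : ℝ) ^ (-β) : ℝ) : ℂ)))
        * ((adelicMeasure β).real (X ∩ integralAdeles ∅) : ℂ) := by
  classical
  have hu : IsUnit (a : ZMod N) := (ZMod.isUnit_iff_coprime a N).2 ha
  have hmeas : MeasurableSet (residueClass N a) := measurableSet_adeleBall _ _
  have hfin := adelicMeasure_inter_lt_top hβ₀ X ∅
  have hpt : ∀ x, ∑ χ : DirichletCharacter ℂ N, χ (a : ZMod N)⁻¹ * charFn χ x
      = (residueClass N a).indicator (fun _ => (N.totient : ℂ)) x := by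
    intro x
    by_cases hx : x ∈ integralAdeles ∅
    · obtain ⟨b, hb⟩ := exists_mem_residueClass (NeZero.ne N) hx
      simp only [charFn_of_mem _ hb]
      rw [DirichletCharacter.sum_char_inv_mul_char_eq ℂ hu, Set.indicator_apply]
      congr 1
      refine propext ⟨fun h => ?_, fun h => natCast_zmod_eq_of_mem h hb⟩
      rwa [residueClass_congr h]
    · simp only [charFn_of_notMem _ hx, mul_zero, Finset.sum_const_zero]
      rw [Set.indicator_of_notMem fun h => hx (residueClass_subset _ _ h)]
  have hint : ∀ χ : DirichletCharacter ℂ N,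
      IntegrableOn (charFn χ) (X ∩ integralAdeles ∅) (adelicMeasure β) := fun χ =>
    Measure.integrableOn_of_bounded hfin.ne (measurable_charFn χ).aestronglyMeasurable (M := 1)
      (Filter.Eventually.of_forall (norm_charFn_le_one χ))
  have h1 : ∫ x in X ∩ integralAdeles ∅,
        ∑ χ : DirichletCharacter ℂ N, χ (a : ZMod N)⁻¹ * charFn χ x ∂adelicMeasure β
      = ∫ x in X ∩ integralAdeles ∅, charFn (1 : DirichletCharacter ℂ N) x ∂adelicMeasure β := by
    rw [integral_finsetSum _ fun χ _ => (hint χ).const_mul _]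
    simp only [integral_const_mul]
    rw [Finset.sum_eq_single (1 : DirichletCharacter ℂ N)]
    · have hu' : IsUnit (a : ZMod N)⁻¹ :=
        isUnit_iff_exists_inv'.2 ⟨a, ZMod.coe_mul_inv_eq_one a ha⟩
      rw [MulChar.one_apply hu', one_mul]
    · intro χ _ hχ
      rw [setIntegral_charFn_eq_zero hβ₀ hβ₁ hXm hX hχ, mul_zero]
    · intro h; exact absurd (Finset.mem_univ _) h
  rw [setIntegral_charFn_one hβ₀ hXm hX] at h1
  rw [← h1]
  simp only [hpt]
  rw [setIntegral_indicator hmeas, Set.inter_assoc, Set.inter_eq_right.2 (residueClass_subset N a),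
    setIntegral_const, Complex.real_smul, mul_comm]

end Invariant

/-! ### Independence and ergodicity -/

section Ergodic

variable {β : ℝ} {X : Set Adeles}

theorem measure_preimage_smul_inter
    (hX : ∀ g : PosRat, (fun x : Adeles => g • x) ⁻¹' X =ᵐ[adelicMeasure β] X) (g : PosRat)
    (Y : Set Adeles) :
    adelicMeasure β ((fun x => g • x) ⁻¹' X ∩ Y) = adelicMeasure β (X ∩ Y) :=
  measure_congr (Filter.EventuallyEq.inter (hX g) (ae_eq_refl Y))

theorem adelicMeasure_integralAdeles_empty (hβ : 0 < β) :
    adelicMeasure β (integralAdeles ∅) = 1 := by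
  rw [adelicMeasure_integralAdeles hβ]; simp

/-- The formula of `totient_mul_measure_residueClass`, compared with its case `X = univ`. -/
theorem measure_inter_residueClass_of_coprime (hβ₀ : 0 < β) (hβ₁ : β ≤ 1) (hXm : MeasurableSet X)
    (hX : ∀ g : PosRat, (fun x : Adeles => g • x) ⁻¹' X =ᵐ[adelicMeasure β] X)
    {N a : ℕ} (hN : N ≠ 0) (ha : a.Coprime N) :
    adelicMeasure β (X ∩ residueClass N a)
      = adelicMeasure β (X ∩ integralAdeles ∅) * adelicMeasure β (residueClass N a) := by
  have : NeZero N := ⟨hN⟩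
  have h1 := totient_mul_measure_residueClass hβ₀ hβ₁ hXm hX ha
  have h2 := totient_mul_measure_residueClass (X := Set.univ) hβ₀ hβ₁ MeasurableSet.univ
    (fun g => by rw [Set.preimage_univ]; exact ae_eq_refl _) ha
  rw [Set.univ_inter, Set.univ_inter, measureReal_def (adelicMeasure β) (integralAdeles ∅),
    adelicMeasure_integralAdeles_empty hβ₀, ENNReal.toReal_one, Complex.ofReal_one, mul_one] at h2
  rw [← h2, mul_assoc] at h1
  have h3 : (N.totient : ℂ) ≠ 0 := by
    exact_mod_cast (Nat.totient_pos.2 (Nat.pos_of_ne_zero hN)).ne'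
  have h4 := mul_left_cancel₀ h3 h1
  have h5 : (adelicMeasure β).real (X ∩ residueClass N a)
      = (adelicMeasure β).real (residueClass N a)
        * (adelicMeasure β).real (X ∩ integralAdeles ∅) := by
    exact_mod_cast h4
  have hfin : ∀ Y : Set Adeles, Y ⊆ integralAdeles ∅ → adelicMeasure β Y ≠ ∞ := fun Y hY =>
    ((measure_mono hY).trans_lt
      (by rw [adelicMeasure_integralAdeles_empty hβ₀]; exact ENNReal.one_lt_top)).ne
  rw [← ENNReal.toReal_eq_toReal_iff'
      (hfin _ (Set.inter_subset_right.trans (residueClass_subset N a)))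
    (ENNReal.mul_ne_top (hfin _ Set.inter_subset_right) (hfin _ (residueClass_subset N a))),
    ENNReal.toReal_mul, mul_comm]
  exact h5

/-- Dividing by `gcd (a, N)` reduces a residue class to an invertible one. -/
theorem measure_inter_residueClass (hβ₀ : 0 < β) (hβ₁ : β ≤ 1) (hXm : MeasurableSet X)
    (hX : ∀ g : PosRat, (fun x : Adeles => g • x) ⁻¹' X =ᵐ[adelicMeasure β] X)
    {N a : ℕ} (hN : N ≠ 0) :
    adelicMeasure β (X ∩ residueClass N a)
      = adelicMeasure β (X ∩ integralAdeles ∅) * adelicMeasure β (residueClass N a) := by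
  obtain ⟨d, a', N', hd, hcop, rfl, rfl⟩ := Nat.exists_coprime' (m := a) (n := N)
    (Nat.gcd_pos_of_pos_right _ (Nat.pos_of_ne_zero hN))
  have hd0 : d ≠ 0 := hd.ne'
  have hpre : (fun x : Adeles => posNat d hd0 • x) ⁻¹' residueClass (N' * d) (a' * d)
      = residueClass N' a' := by
    ext x
    rw [Set.mem_preimage, mul_comm N', mul_comm a', posNat_smul_mem_residueClass]
  have hmeas : MeasurableSet (residueClass (N' * d) (a' * d)) := measurableSet_adeleBall _ _
  have h1 := preimage_smul_nat hβ₀ hd0 (hXm.inter hmeas)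
  have h2 := preimage_smul_nat hβ₀ hd0 hmeas
  rw [Set.preimage_inter, hpre, measure_preimage_smul_inter hX,
    measure_inter_residueClass_of_coprime hβ₀ hβ₁ hXm hX (left_ne_zero_of_mul hN) hcop] at h1
  rw [hpre] at h2
  rw [h2, mul_left_comm] at h1
  refine ((ENNReal.mul_right_inj ?_ ENNReal.ofReal_ne_top).1 h1).symm
  have : (0 : ℝ) < d := by exact_mod_cast hd
  rw [Ne, ENNReal.ofReal_eq_zero, not_le]
  positivity

/-- An invariant set is independent of every Borel set of integral adeles. -/
theorem measure_inter_integralAdeles (hβ₀ : 0 < β) (hβ₁ : β ≤ 1) (hXm : MeasurableSet X)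
    (hX : ∀ g : PosRat, (fun x : Adeles => g • x) ⁻¹' X =ᵐ[adelicMeasure β] X)
    {Y : Set Adeles} (hY : MeasurableSet Y) :
    adelicMeasure β (Y ∩ (X ∩ integralAdeles ∅))
      = adelicMeasure β (X ∩ integralAdeles ∅) * adelicMeasure β (Y ∩ integralAdeles ∅) := by
  have hW := measurableSet_integralAdeles ∅
  suffices h : (adelicMeasure β).restrict (X ∩ integralAdeles ∅)
      = adelicMeasure β (X ∩ integralAdeles ∅) • (adelicMeasure β).restrict (integralAdeles ∅) by
    have := congrArg (fun m => m Y) h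
    simpa only [Measure.restrict_apply hY, Measure.smul_apply, smul_eq_mul] using this
  refine ext_of_rationalBalls (fun r N hN => ?_) fun r k => ?_
  · exact (Measure.restrict_apply_le _ _).trans_lt (adelicMeasure_ball_lt_top hβ₀ r hN)
  · have hm := measurableSet_adeleBall (diag r) ((k.factorial : ℕ) : ℚ)
    rw [Measure.smul_apply, smul_eq_mul, Measure.restrict_apply hm, Measure.restrict_apply hm]
    by_cases hne : (adeleBall (diag r) ((k.factorial : ℕ) : ℚ) ∩ integralAdeles ∅).Nonempty
    · -- A ball meeting the integral adeles is a residue class.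
      obtain ⟨x, hx, hxW⟩ := hne
      obtain ⟨a, ha⟩ := exists_mem_residueClass (Nat.factorial_ne_zero k) hxW
      have hball : adeleBall (diag r) ((k.factorial : ℕ) : ℚ) = residueClass k.factorial a :=
        (adeleBall_eq_of_mem hx).symm.trans (adeleBall_eq_of_mem ha)
      have hsub := residueClass_subset k.factorial a
      rw [hball, Set.inter_eq_left.2 hsub, ← Set.inter_assoc, Set.inter_comm _ X, Set.inter_assoc,
        Set.inter_eq_left.2 hsub]
      exact measure_inter_residueClass hβ₀ hβ₁ hXm hX (Nat.factorial_ne_zero k)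
    · rw [Set.not_nonempty_iff_eq_empty] at hne
      rw [hne, Set.inter_comm X, ← Set.inter_assoc, hne, Set.empty_inter, measure_empty, mul_zero]

/-- Every adele has an integral multiple, so an invariant set is null as soon as its integral part
is. -/
theorem measure_eq_zero_of_inter (hβ₀ : 0 < β) (hXm : MeasurableSet X)
    (hX : ∀ g : PosRat, (fun x : Adeles => g • x) ⁻¹' X =ᵐ[adelicMeasure β] X)
    (h : adelicMeasure β (X ∩ integralAdeles ∅) = 0) : adelicMeasure β X = 0 := by
  have hW := measurableSet_integralAdeles ∅
  have hsub : X ⊆ ⋃ g : PosRat, X ∩ (fun x : Adeles => g • x) ⁻¹' integralAdeles ∅ := by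
    intro x hx
    obtain ⟨m, hm, hmx⟩ := exists_nat_mul_integral x
    refine Set.mem_iUnion.2 ⟨posNat m hm, hx, fun p => ?_, by simp⟩
    rw [posNat_smul_apply]
    exact hmx p
  refine measure_mono_null hsub (measure_iUnion_null fun g => ?_)
  rw [← measure_preimage_smul_inter hX g, ← Set.preimage_inter]
  exact preimage_smul_null hβ₀ g (hXm.inter hW) h

end Ergodic

end FiniteAdele

end

theorem mainTheorem1 (β : ℝ) (hβ₀ : 0 < β) (hβ₁ : β ≤ 1) :
    FiniteAdele.IsErgodicAction FiniteAdele.PosRat (FiniteAdele.adelicMeasure β) := by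
  refine ⟨fun g => ⟨FiniteAdele.measurable_smul g, ?_⟩, fun X hXm hX => ?_⟩
  · refine MeasureTheory.Measure.AbsolutelyContinuous.mk fun E hE h => ?_
    rw [MeasureTheory.Measure.map_apply (FiniteAdele.measurable_smul g) hE]
    exact FiniteAdele.preimage_smul_null hβ₀ g hE h
  · -- The set `X` is independent of its own complement.
    have h := FiniteAdele.measure_inter_integralAdeles hβ₀ hβ₁ hXm hX hXm.compl
    rw [← Set.inter_assoc, Set.compl_inter_self, Set.empty_inter, MeasureTheory.measure_empty] at h
    refine (mul_eq_zero.1 h.symm).imp (FiniteAdele.measure_eq_zero_of_inter hβ₀ hXm hX)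
      (FiniteAdele.measure_eq_zero_of_inter hβ₀ hXm.compl fun g => ?_)
    rw [Set.preimage_compl]
    exact (hX g).compl
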